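/- A virtual diagram is an oriented 4-valent diagram in the plane $\mathbb{R}^2$ (a generic immersion of finitely many oriented circles), each of whose double points is marked either as a classical crossing (with an over- and an undercrossing strand, and a local writhe $\pm1$) or as a virtual crossing. A virtual link is an equivalence class of virtual diagrams modulo generalised Reidemeister moves, i.e. the usual Reidemeister moves on classical crossings and the detour move, which replaces an arc containing only virtual crossings by any other such arc with the same ends. Let $D$ be a virtual diagram. Delete all virtual crossings and cut the lower strand at every classical crossing; the connected components of the result are the arcs of $D$. Two arcs lie on the same long arc if one can pass from one to the other by going straight through virtual crossings. Assume that $D$ is proper, i.e. no long arc is cyclic (every link component of $D$ goes under some classical crossing). Let $v_1,\dots,v_n$ be the classical crossings, and let $\gamma^j$ be the long arc that emanates from the undercrossing of $v_j$; let $\gamma^j_0,\dots,\gamma^j_{k_j}$ be its arcs in the order of the orientation. Put $\deg\gamma^j_0=0$ and $\deg\gamma^j_{\mu+1}=\deg\gamma^j_\mu\pm1$, with $+1$ if at the virtual crossing between $\gamma^j_\mu$ and $\gamma^j_{\mu+1}$ the other strand goes from the left to the right (an increasing passage) and $-1$ if it goes from the right to the left. Let $p_j$ be the number of increasing passages on $\gamma^j$.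 Then $\deg\gamma^j_\mu\le p_j$ for all $\mu$; an arc $\gamma^j_\mu$ with $\deg\gamma^j_\mu=p_j$ is called critical (it is then $\gamma^j_{p_j}$), and $D$ is called special if every long arc contains a critical arc. A classical crossing $v_i$ and an arc are incident if the arc emanates from the undercrossing of $v_i$, passes over $v_i$, or comes into the undercrossing of $v_i$; $v_i$ is called cyclic if some arc does all three at $v_i$. For a special diagram let $M(D)$ be the $n\times n$ matrix with $M_{ij}=1$ if $v_i$ is incident with the critical arc of $\gamma^j$ and $M_{ij}=0$ otherwise. **Theorem.** Let $D$ be a proper special virtual diagram without cyclic classical crossings such that $\operatorname{per} M(D)=1$, i.e. there is exactly one bijective pairing of the classical crossings with incident critical arcs. Then $D$ has the least number of virtual crossings among all virtual diagrams that represent the same virtual link. -/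

import Mathlib

namespace VirtualKnot

/-- Number of classes of the equivalence relation generated by `a ~ f a`. -/
noncomputable def numOrbits {α : Type} (f : α → α) : ℕ :=
  Nat.card (Quot fun a b : α => f a = b)

/-- Combinatorial data of an oriented four-valent diagram (drawn on some closed oriented surface;
planarity is imposed below).

`C` and `V` are the sets of classical and of virtual crossings. Walking along the link, every
crossing is passed twice; the two passages through a crossing `x` are `(x, true)` and `(x, false)`.
* At a classical crossing, `true` is the overpass and `false` is the underpass.
* At a virtual crossing, `true` is the passage for which the other strand goes from the left to the
  right, and `false` is the passage for which the other strand goes from the right to the left.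

`next p` is the passage that comes after `p` along the orientation. The edges of the four-valent
graph correspond to the passages: edge `p` leads from the passage `p` to the passage `next p`.
`sign` is the local writhe, and `loops` is the number of closed curves that pass no crossing. -/
structure DiagramData where
  C : Type
  V : Type
  [fintypeC : Fintype C]
  [fintypeV : Fintype V]
  [decEqC : DecidableEq C]
  [decEqV : DecidableEq V]
  next : Equiv.Perm ((C ⊕ V) × Bool)
  sign : C → ℤˣ
  loops : ℕ

attribute [instance] DiagramData.fintypeC DiagramData.fintypeV
attribute [instance] DiagramData.decEqC DiagramData.decEqV

namespace DiagramData

variable (D : DiagramData)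

abbrev Crossing : Type := D.C ⊕ D.V

abbrev Passage : Type := D.Crossing × Bool

/-- The overpass at a classical crossing. -/
def overpass (c : D.C) : D.Passage := (Sum.inl c, true)

/-- The underpass at a classical crossing. -/
def underpass (c : D.C) : D.Passage := (Sum.inl c, false)

/-- The other passage through the same crossing. -/
def other (p : D.Passage) : D.Passage := (p.1, !p.2)

/-- Whether, seen from the passage `p`, the other strand at this crossing goes from the left to the
right. At a positive classical crossing the lower strand goes from the right to the left of
the upper one, at a negative one from the left to the right. -/
def otherGoesLeftToRight : D.Passage → Bool
  | (Sum.inl c, b) => if D.sign c = 1 then !b else b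
  | (Sum.inr _, b) => b

/-- A dart is an edge together with a direction: `(p, true)` traverses the edge from `p` to `next p`
along the orientation, `(p, false)` traverses it against the orientation. -/
abbrev Dart : Type := D.Passage × Bool

/-- The next dart along the boundary of the face that lies to the left: at the crossing where the
dart ends, turn left. -/
def faceNext : D.Dart → D.Dart
  | (p, true) =>
      if D.otherGoesLeftToRight (D.next p) then (D.next.symm (D.other (D.next p)), false)
      else (D.other (D.next p), true)
  | (p, false) =>
      if D.otherGoesLeftToRight p then (D.other p, true)
      else (D.next.symm (D.other p), false)

noncomputable def numFaces : ℕ := numOrbits D.faceNext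

/-- Number of connected components of the four-valent graph. -/
noncomputable def numPieces : ℕ :=
  Nat.card (Quot fun x y : D.Crossing => ∃ a b : Bool, D.next (x, a) = (y, b))

/-- Every connected component of the four-valent graph is drawn on a sphere, i.e.
`#vertices - #edges + #faces = 2 * #components`, where `#edges = 2 * #vertices`. (Each component has
`#vertices - #edges + #faces ≤ 2`, so the equality for the sum is the equality for each.) -/
def IsPlanar : Prop :=
  D.numFaces = Fintype.card D.Crossing + 2 * D.numPieces

/-- Number of components of the link. -/
noncomputable def numComponents : ℕ := numOrbits D.next + D.loops

end DiagramData

/-- An (oriented) virtual diagram: a four-valent diagram in the plane whose crossings are classical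
or virtual. -/
structure VirtualDiagram extends DiagramData where
  planar : toDiagramData.IsPlanar

/-! ### Generalised Reidemeister moves -/

/-- `ρ` is the map of first return of `π` to the subset `ι '' β`: from `ι b`, following `π`, the
first point of the range of `ι` that is met is `ι (ρ b)`. -/
def IsFirstReturn {α β : Type} (π : Equiv.Perm α) (ι : β → α) (ρ : β → β) : Prop :=
  ∀ b, ∃ k : ℕ, (π ^ (k + 1)) (ι b) = ι (ρ b) ∧ ∀ j < k, (π ^ (j + 1)) (ι b) ∉ Set.range ι

namespace DiagramData

/-- `D'` is obtained from `D` by removing the set `S` of classical crossings and joining the edges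
along the strands; every virtual crossing and every component of the link is kept (a component
that loses its last crossing becomes a closed curve without crossings). -/
def IsErasure (D D' : DiagramData) (S : Set D.C) : Prop :=
  ∃ (ι : D'.C ↪ D.C) (e : D'.V ≃ D.V),
    Set.range ι = Sᶜ ∧
    (∀ c, D'.sign c = D.sign (ι c)) ∧
    IsFirstReturn D.next (fun p : D'.Passage => (Sum.map ι e p.1, p.2)) D'.next ∧
    D'.numComponents = D.numComponents

/-- First Reidemeister move (removing a curl): an edge leads from the classical crossing `c` directly
to `c`, and `c` is removed. -/
def Reidemeister1 (D D' : DiagramData) : Prop :=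
  ∃ (c : D.C) (b : Bool), D.next (Sum.inl c, b) = (Sum.inl c, !b) ∧ D.IsErasure D' {c}

/-- Second Reidemeister move (removing a bigon): an edge of the upper strand leads directly from the
classical crossing `c` to the classical crossing `d` of opposite sign, and an edge of the lower
strand leads directly from `c` to `d` or from `d` to `c`; both crossings are removed. -/
def Reidemeister2 (D D' : DiagramData) : Prop :=
  ∃ c d : D.C, D.sign d = -D.sign c ∧
    D.next (D.overpass c) = D.overpass d ∧
    (D.next (D.underpass c) = D.underpass d ∨ D.next (D.underpass d) = D.underpass c) ∧
    D.IsErasure D' {c, d}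

/-- An edge joins `p` and `q`, from `p` to `q` if `o = 1`, from `q` to `p` if `o = -1`. -/
def Joined (D : DiagramData) (o : ℤˣ) (p q : D.Passage) : Prop :=
  (o = 1 ∧ D.next p = q) ∨ (o = -1 ∧ D.next q = p)

/-- Third Reidemeister move. Three strands, an upper, a middle and a lower one, form a triangle with
classical crossings `x` (upper over middle), `y` (upper over lower), `z` (middle over lower). The
move exchanges the two passages on each of the three strands.

The condition on the signs says that the three edges bound a triangular face: for three lines with
directions `oT (y - x)`, `oM (z - x)`, `oB (z - y)`, the orientation of the triangle `x y z` is
`τ = sign x * oT * oM = sign y * oT * oB = sign z * oM * oB`. -/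
def Reidemeister3 (D D' : DiagramData) : Prop :=
  ∃ (x y z : D.C) (oT oM oB τ : ℤˣ) (eC : D.C ≃ D'.C) (eV : D.V ≃ D'.V),
    x ≠ y ∧ x ≠ z ∧ y ≠ z ∧
    D.Joined oT (D.overpass x) (D.overpass y) ∧
    D.Joined oM (D.underpass x) (D.overpass z) ∧
    D.Joined oB (D.underpass y) (D.underpass z) ∧
    D.sign x = τ * oT * oM ∧ D.sign y = τ * oT * oB ∧ D.sign z = τ * oM * oB ∧
    (∀ c, D'.sign (eC c) = D.sign c) ∧
    D'.loops = D.loops ∧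
    (let σ : Equiv.Perm D.Passage :=
        Equiv.swap (D.overpass x) (D.overpass y) * Equiv.swap (D.underpass x) (D.overpass z) *
          Equiv.swap (D.underpass y) (D.underpass z)
     ∀ p, D'.next (Sum.map eC eV (σ p).1, (σ p).2) =
        (Sum.map eC eV (σ (D.next p)).1, (σ (D.next p)).2))

/-- Detour moves (and isotopies of the plane): the two diagrams have the same classical crossings,
with the same signs, joined in the same order by arcs that contain only virtual crossings, and they
have the same number of components. Each of these arcs, and each closed curve without classical
crossings, may have been replaced by any other curve with the same ends that meets the
diagram in virtual crossings only. -/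
def Detour (D D' : DiagramData) : Prop :=
  ∃ (e : D.C ≃ D'.C) (ρ : D.C × Bool → D.C × Bool),
    (∀ c, D'.sign (e c) = D.sign c) ∧
    IsFirstReturn D.next (fun p : D.C × Bool => ((Sum.inl p.1, p.2) : D.Passage)) ρ ∧
    IsFirstReturn D'.next (fun p : D.C × Bool => ((Sum.inl (e p.1), p.2) : D'.Passage)) ρ ∧
    D'.numComponents = D.numComponents

end DiagramData

namespace VirtualDiagram

/-- One generalised Reidemeister move between virtual diagrams (up to direction). -/
def Move (D D' : VirtualDiagram) : Prop :=
  D.Reidemeister1 D'.toDiagramData ∨ D.Reidemeister2 D'.toDiagramData ∨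
    D.Reidemeister3 D'.toDiagramData ∨ D.Detour D'.toDiagramData

/-- The virtual link of a diagram: its class modulo generalised Reidemeister moves. -/
def link (D : VirtualDiagram) : Quotient (Relation.EqvGen.setoid Move) := Quotient.mk _ D

/-- The number of virtual crossings. -/
def numVirtual (D : VirtualDiagram) : ℕ := Fintype.card D.V

/-- `D` has the least number of virtual crossings among all diagrams of its virtual link. -/
def IsMinimal (D : VirtualDiagram) : Prop :=
  ∀ D' : VirtualDiagram, D'.link = D.link → D.numVirtual ≤ D'.numVirtual

end VirtualDiagram

/-! ### Arcs and long arcs -/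

namespace DiagramData

variable (D : DiagramData)

def isVirtual (p : D.Passage) : Bool := p.1.isRight

def isUnder (p : D.Passage) : Bool := p.1.isLeft && !p.2

/-- The `m`-th passage after the underpass of `j`. -/
def point (j : D.C) (m : ℕ) : D.Passage := (D.next ^ m) (D.underpass j)

/-- The diagram has no cyclic long arc: every closed curve goes under some classical crossing. -/
def IsProper : Prop :=
  D.loops = 0 ∧ ∀ p : D.Passage, ∃ m : ℕ, D.isUnder ((D.next ^ m) p) = true

/-- The long arc of the crossing `j` emanates from the underpass of `j` and ends at the next
underpass. It consists of `arcLength j` edges, the edge number `m < arcLength j` leading from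
`point j m` to `point j (m + 1)`. -/
noncomputable def arcLength (j : D.C) : ℕ :=
  sInf {m : ℕ | 0 < m ∧ D.isUnder (D.point j m) = true}

/-- The (short) arcs of the long arc of `j` are separated by its virtual passages and are numbered
`0, 1, 2, …` along the long arc. The edge number `m` lies on the arc with the number `arcNumber j m`. -/
def arcNumber (j : D.C) (m : ℕ) : ℕ :=
  ((Finset.Icc 1 m).filter fun k => D.isVirtual (D.point j k) = true).card

/-- `1` for an increasing virtual passage (the other strand goes from the left to the right), `-1`
for a decreasing one. -/
def step : D.Passage → ℤ
  | (Sum.inl _, _) => 0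
  | (Sum.inr _, true) => 1
  | (Sum.inr _, false) => -1

/-- The degree of the arc that contains the edge number `m` of the long arc of `j`. -/
def degree (j : D.C) (m : ℕ) : ℤ := ∑ k ∈ Finset.Icc 1 m, D.step (D.point j k)

/-- The number of increasing virtual passages on the long arc of `j`. -/
noncomputable def numIncreasing (j : D.C) : ℕ :=
  ((Finset.Ico 1 (D.arcLength j)).filter fun k => D.step (D.point j k) = 1).card

/-- The arc number `μ` of the long arc of `j` is critical: its degree is the greatest possible one,
the number of increasing virtual passages of the long arc. -/
def IsCritical (j : D.C) (μ : ℕ) : Prop :=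
  ∃ m < D.arcLength j, D.arcNumber j m = μ ∧ D.degree j m = D.numIncreasing j

/-- Every long arc contains a critical arc. -/
def IsSpecial : Prop := ∀ j : D.C, ∃ μ : ℕ, D.IsCritical j μ

/-- The arc number `μ` of the long arc of `j` emanates from the classical crossing `i`. -/
def Emanates (i j : D.C) (μ : ℕ) : Prop := i = j ∧ μ = 0

/-- The arc number `μ` of the long arc of `j` passes (over) through the classical crossing `i`. -/
def PassesThrough (i j : D.C) (μ : ℕ) : Prop :=
  ∃ m < D.arcLength j, D.arcNumber j m = μ ∧ D.point j m = D.overpass i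

/-- The arc number `μ` of the long arc of `j` comes into the classical crossing `i`. -/
def ComesInto (i j : D.C) (μ : ℕ) : Prop :=
  D.arcNumber j (D.arcLength j) = μ ∧ D.point j (D.arcLength j) = D.underpass i

/-- The classical crossing `i` and the arc number `μ` of the long arc of `j` are incident. -/
def Incident (i j : D.C) (μ : ℕ) : Prop :=
  D.Emanates i j μ ∨ D.PassesThrough i j μ ∨ D.ComesInto i j μ

/-- The classical crossing `i` is cyclic: some arc emanates from it, passes through it and comes
into it. -/
def IsCyclic (i : D.C) : Prop :=
  ∃ (j : D.C) (μ : ℕ), D.Emanates i j μ ∧ D.PassesThrough i j μ ∧ D.ComesInto i j μ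

open Classical in
/-- The incidence matrix: the entry `(i, j)` tells whether the classical crossing `i` and the
critical arc of the long arc of `j` are incident. -/
noncomputable def incidenceMatrix : Matrix D.C D.C ℕ :=
  Matrix.of fun i j => if ∃ μ : ℕ, D.IsCritical j μ ∧ D.Incident i j μ then 1 else 0

end DiagramData

end VirtualKnot

/-!
The edges of a diagram are labelled by real numbers subject to linear equations with a parameter `u`:
at a classical crossing the label is constant on the upper strand and is reflected in the label of the
upper strand on the lower one (Fox colourings, the Alexander module at `t = -1`); at an increasing
virtual passage the label is multiplied by `s = u⁻¹`, at a decreasing one by `u = s⁻¹`. The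
determinant of this system, `coloringDet`, is an invariant of virtual links up to a constant factor
(`VirtualDiagram.proportionalDet_of_link_eq`), so that its degree in `s` is an invariant.

Invariance under Reidemeister moves is a matter of changing labels and equations by operations that do
not involve `u`. When a crossing is removed, its equations are first transformed into
`outgoing = incoming`, and such passages can be skipped (`IsFirstReturn.exists_det_eq`). For detour
moves planarity is needed: by Euler's formula, the faces of a planar diagram have an Alexander
numbering (`DiagramData.exists_alexander_numbering`). Rescaling each label by the power of `u` given
by the number of the face on its left changes the equations at the virtual passages into
`outgoing = incoming`, and those at the classical crossings into equations that depend on the signs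
only (`DiagramData.det_coloringMap_eq_det_gaugedMap`). Hence the determinant depends on the classical
data only.

For every diagram the degree in `s` is at most the number of virtual crossings, since only the
increasing virtual passages contribute. It remains to see that equality holds for the diagram of the
theorem, that is, that the equations remain regular when the increasing ones are multiplied by `u` and
`u` is set to `0` (`DiagramData.det_scaledMap_zero_ne_zero`). Then the label vanishes before each
increasing and after each decreasing virtual passage, so that only the critical arcs carry labels. The
equations at the underpasses become a square system whose coefficient at `(i, j)` is nonzero exactly
when the crossing `i` and the critical arc of the long arc of `j` are incident. As the incidence matrix
has permanent `1`, the determinant of this system has a single nonzero term.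
-/

namespace VirtualKnot

/-! ### First return maps -/

section FirstReturn

variable {P P' : Type} {π : Equiv.Perm P} {ι : P' → P} {ρ : P' → P'}

/-- The first return map is injective: of two points with the same image, the one with the longer way
would meet the other one on this way. -/
theorem IsFirstReturn.injective (h : IsFirstReturn π ι ρ) (hι : Function.Injective ι) :
    Function.Injective ρ := by
  have key : ∀ b b' k k' : _, k ≤ k' → ρ b = ρ b' → (π ^ (k + 1)) (ι b) = ι (ρ b) →
      (π ^ (k' + 1)) (ι b') = ι (ρ b') → (∀ j < k', (π ^ (j + 1)) (ι b') ∉ Set.range ι) →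
      b = b' := by
    intro b b' k k' hk hb e e' hj
    obtain ⟨d, rfl⟩ := Nat.exists_eq_add_of_le hk
    have e1 : (π ^ d) (ι b') = ι b := by
      apply (π ^ (k + 1)).injective
      rw [e, hb, ← e', ← Equiv.Perm.mul_apply, ← pow_add]
      congr 2
      omega
    rcases d with _ | d
    · exact hι (by simpa using e1.symm)
    · exact absurd ⟨b, e1.symm⟩ (hj d (by omega))
  intro b b' hb
  obtain ⟨k, e, hj⟩ := h b
  obtain ⟨k', e', hj'⟩ := h b'
  rcases le_total k k' with hk | hk
  · exact key b b' k k' hk hb e e' hj'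
  · exact (key b' b k' k hk hb.symm e' e hj).symm

theorem quot_mk_eq_iff_sameCycle (a b : P) :
    Quot.mk (fun a b : P => π a = b) a = Quot.mk _ b ↔ π.SameCycle a b := by
  constructor
  · intro h
    have h' := Quot.eqvGen_exact h
    clear h
    induction h' with
    | rel x y hxy => exact ⟨1, by simpa using hxy⟩
    | refl x => exact Equiv.Perm.SameCycle.refl _ _
    | symm x y _ ih => exact ih.symm
    | trans x y z _ _ ih1 ih2 => exact ih1.trans ih2
  · rintro ⟨i, rfl⟩
    induction i with
    | zero => simp
    | succ i ih =>
      have e : π ((π ^ (i : ℤ)) a) = (π ^ ((i : ℤ) + 1)) a := by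
        rw [← Equiv.Perm.mul_apply, ← zpow_one_add, add_comm]
      exact ih.trans (Quot.sound e)
    | pred i ih =>
      have e : π ((π ^ (-(i : ℤ) - 1)) a) = (π ^ (-(i : ℤ))) a := by
        rw [← Equiv.Perm.mul_apply, ← zpow_one_add, add_sub_cancel]
      exact ih.trans (Quot.sound (r := fun a b : P => π a = b) e).symm

/-- Two points of `P'` on a common cycle of `π` are on a common cycle of the first return map. -/
theorem IsFirstReturn.quot_eq [Finite P] (h : IsFirstReturn π ι ρ) (hι : Function.Injective ι)
    {b b' : P'} (hb : π.SameCycle (ι b) (ι b')) :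
    Quot.mk (fun a b : P' => ρ a = b) b = Quot.mk _ b' := by
  obtain ⟨n, hn⟩ := hb.exists_nat_pow_eq
  clear hb
  induction n using Nat.strong_induction_on generalizing b with
  | _ n ih =>
    obtain ⟨k, e, hj⟩ := h b
    rcases Nat.eq_zero_or_pos n with rfl | hpos
    · exact congrArg _ (hι (by simpa using hn))
    · by_cases hk : k + 1 ≤ n
      · obtain ⟨d, rfl⟩ := Nat.exists_eq_add_of_le hk
        have : (π ^ d) (ι (ρ b)) = ι b' := by
          rw [← e, ← Equiv.Perm.mul_apply, ← pow_add, ← hn, add_comm]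
        exact (Quot.sound rfl : Quot.mk _ b = Quot.mk _ (ρ b)).trans (ih d (by omega) this)
      · obtain ⟨j, rfl⟩ := Nat.exists_eq_succ_of_ne_zero hpos.ne'
        exact absurd ⟨b', hn.symm⟩ (hj j (by omega))

/-- The cycles of the first return map are the cycles of `π` that meet the subset. -/
theorem IsFirstReturn.numOrbits [Finite P] (h : IsFirstReturn π ι ρ)
    (hι : Function.Injective ι) :
    ((∀ p, ∃ b, π.SameCycle p (ι b)) ∧ numOrbits π = numOrbits ρ) ∨
      ((∃ p, ∀ b, ¬ π.SameCycle p (ι b)) ∧ numOrbits ρ < numOrbits π) := by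
  let F : Quot (fun a b : P' => ρ a = b) → Quot (fun a b : P => π a = b) :=
    Quot.lift (fun b => Quot.mk _ (ι b)) (by
      rintro a b rfl
      obtain ⟨k, e, -⟩ := h a
      exact (quot_mk_eq_iff_sameCycle _ _).2 ⟨k + 1, by exact_mod_cast e⟩)
  have hF : Function.Injective F := by
    rintro ⟨a⟩ ⟨b⟩ hab
    exact h.quot_eq hι ((quot_mk_eq_iff_sameCycle _ _).1 hab)
  have : Finite P' := Finite.of_injective ι hι
  by_cases hs : ∀ p, ∃ b, π.SameCycle p (ι b)
  · refine .inl ⟨hs, (Nat.card_congr (Equiv.ofBijective F ⟨hF, ?_⟩)).symm⟩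
    rintro ⟨p⟩
    obtain ⟨b, hb⟩ := hs p
    exact ⟨Quot.mk _ b, ((quot_mk_eq_iff_sameCycle _ _).2 hb).symm⟩
  · push Not at hs
    refine .inr ⟨hs, ?_⟩
    obtain ⟨p, hp⟩ := hs
    refine lt_of_le_of_ne (Nat.card_le_card_of_injective F hF) fun he => ?_
    obtain ⟨⟨b⟩, hb⟩ := ((Nat.bijective_iff_injective_and_card F).2 ⟨hF, he⟩).2 (Quot.mk _ p)
    exact hp b ((quot_mk_eq_iff_sameCycle _ _).1 hb).symm

/-- Linear equations for edge labels `x` (where `x p` is the label of the edge that leaves `p`).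
At the points of `P'` they are any linear equations `R (outgoing labels, incoming labels) = 0`; at
the other points of `P` they say that the label does not change. Removing these other points
multiplies the determinant by a nonzero constant that does not depend on `R`. -/
theorem IsFirstReturn.exists_det_eq [Finite P] [Finite P'] {ρ : Equiv.Perm P'} (h : IsFirstReturn π ι ρ)
    (hι : Function.Injective ι) (hs : ∀ p, ∃ b, π.SameCycle p (ι b)) :
    ∃ c : ℝ, c ≠ 0 ∧ ∀ (R : ((P' → ℝ) × (P' → ℝ)) →ₗ[ℝ] (P' → ℝ))
      (L : (P → ℝ) →ₗ[ℝ] (P → ℝ)) (L' : (P' → ℝ) →ₗ[ℝ] (P' → ℝ)),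
      (∀ x b, L x (ι b) = R (x ∘ ι, x ∘ π.symm ∘ ι) b) →
      (∀ x p, p ∉ Set.range ι → L x p = x p - x (π.symm p)) →
      (∀ x, L' x = R (x, x ∘ ρ.symm)) →
      LinearMap.det L = c * LinearMap.det L' := by
  classical
  have := Fintype.ofFinite P
  have := Fintype.ofFinite P'
  -- `Φ` replaces the labels outside of `P'` by their increments; in these coordinates the matrix of
  -- `L` is block triangular, with the blocks `L'` and `1`
  let Φ : (P → ℝ) →ₗ[ℝ] (P → ℝ) :=
    { toFun := fun x p => if p ∈ Set.range ι then x p else x p - x (π.symm p)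
      map_add' := by
        intro x y
        ext p
        by_cases hp : p ∈ Set.range ι <;> simp only [hp, if_true, if_false, Pi.add_apply]
        ring
      map_smul' := by
        intro a x
        ext p
        by_cases hp : p ∈ Set.range ι <;>
          simp only [hp, if_true, if_false, Pi.smul_apply, smul_eq_mul, RingHom.id_apply]
        ring }
  have hΦr : ∀ x b, Φ x (ι b) = x (ι b) := fun x b => if_pos ⟨b, rfl⟩
  have hΦn : ∀ x p, p ∉ Set.range ι → Φ x p = x p - x (π.symm p) := fun x p hp => if_neg hp
  have hinj : Function.Injective Φ := by
    rw [← LinearMap.ker_eq_bot, LinearMap.ker_eq_bot']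
    intro x hx
    ext p
    obtain ⟨b, hb⟩ := hs p
    obtain ⟨n, rfl⟩ := hb.symm.exists_nat_pow_eq
    clear hb
    induction n with
    | zero => simpa [hΦr] using congrFun hx (ι b)
    | succ n ih =>
      by_cases hp : (π ^ (n + 1)) (ι b) ∈ Set.range ι
      · obtain ⟨b', hb'⟩ := hp
        rw [← hb', ← hΦr x b', hx]
      · have h1 := hΦn x _ hp
        rw [hx, pow_succ', Equiv.Perm.mul_apply, Equiv.symm_apply_apply, ih] at h1
        rw [pow_succ', Equiv.Perm.mul_apply]
        simpa using h1.symm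
  let Ψ : (P → ℝ) ≃ₗ[ℝ] (P → ℝ) := LinearEquiv.ofInjectiveEndo Φ hinj
  have hΨ : ∀ x, Ψ x = Φ x := fun x => rfl
  refine ⟨LinearMap.det (Ψ : (P → ℝ) →ₗ[ℝ] (P → ℝ)), (LinearEquiv.isUnit_det' Ψ).ne_zero, ?_⟩
  intro R L L' hr hn hL'
  let M : (P → ℝ) →ₗ[ℝ] (P → ℝ) := L ∘ₗ (Ψ.symm : (P → ℝ) →ₗ[ℝ] (P → ℝ))
  have hM : L = M ∘ₗ (Ψ : (P → ℝ) →ₗ[ℝ] (P → ℝ)) := by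
    refine LinearMap.ext fun x => ?_
    simp [M]
  have hMn : ∀ y p, p ∉ Set.range ι → M y p = y p := by
    intro y p hp
    have : M y p = L (Ψ.symm y) p := rfl
    rw [this, hn _ _ hp, ← hΦn _ _ hp, ← hΨ, LinearEquiv.apply_symm_apply]
  have hMr : ∀ y, (∀ p, p ∉ Set.range ι → y p = 0) → ∀ b, M y (ι b) = L' (y ∘ ι) b := by
    intro y hy b
    have e0 : M y (ι b) = L (Ψ.symm y) (ι b) := rfl
    obtain ⟨x, rfl⟩ := Ψ.surjective y
    rw [LinearEquiv.symm_apply_apply] at e0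
    have e1 : Ψ x ∘ ι = x ∘ ι := funext fun b => hΦr x b
    have e2 : ∀ p, p ∉ Set.range ι → x p = x (π.symm p) := by
      intro p hp
      have := hy p hp
      rw [hΨ, hΦn x p hp] at this
      linarith
    rw [e0, hr, hL', e1]
    suffices x ∘ π.symm ∘ ι = (x ∘ ι) ∘ ρ.symm by rw [this]
    ext b
    obtain ⟨a, rfl⟩ := ρ.surjective b
    obtain ⟨k, e, hj⟩ := h a
    have e3 : ∀ j ≤ k, x ((π ^ j) (ι a)) = x (ι a) := by
      intro j hjk
      induction j with
      | zero => simp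
      | succ j ih =>
        rw [e2 _ (hj j hjk), pow_succ', Equiv.Perm.mul_apply, Equiv.symm_apply_apply]
        exact ih (by omega)
    have e4 : π.symm (ι (ρ a)) = (π ^ k) (ι a) := by
      rw [← e, pow_succ', Equiv.Perm.mul_apply, Equiv.symm_apply_apply]
    simp only [Function.comp_apply, Equiv.symm_apply_apply, e4, e3 k le_rfl]
  have hdet : LinearMap.det M = LinearMap.det L' := by
    rw [← LinearMap.det_toMatrix', ← LinearMap.det_toMatrix',
      Matrix.twoBlockTriangular_det _ (fun p => p ∈ Set.range ι)]
    · have b2 : Matrix.toSquareBlockProp (LinearMap.toMatrix' M) (fun p => ¬ p ∈ Set.range ι) = 1 := by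
        ext ⟨i, hi⟩ ⟨j, hj⟩
        simp only [Matrix.toSquareBlockProp_def, Matrix.of_apply, LinearMap.toMatrix'_apply]
        rw [hMn _ _ hi]
        simp [Matrix.one_apply, Pi.single_apply]
      have b1 : (Matrix.toSquareBlockProp (LinearMap.toMatrix' M) (fun p => p ∈ Set.range ι)).submatrix
          (Equiv.ofInjective ι hι) (Equiv.ofInjective ι hι) = LinearMap.toMatrix' L' := by
        ext i j
        simp only [Matrix.toSquareBlockProp_def, Matrix.submatrix_apply, Matrix.of_apply,
          LinearMap.toMatrix'_apply, Equiv.ofInjective_apply]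
        rw [hMr]
        · have : (Pi.single (ι j) 1 : P → ℝ) ∘ ι = Pi.single j 1 := by
            ext k
            simp [Pi.single_apply, hι.eq_iff]
          exact congrArg (fun y => L' y i) this
        · intro p hp
          rw [Pi.single_apply, if_neg]
          rintro rfl
          exact hp ⟨j, rfl⟩
      rw [b2, Matrix.det_one, mul_one, ← b1, Matrix.det_submatrix_equiv_self]
      congr!
    · intro i hi j hj
      rw [LinearMap.toMatrix'_apply, hMn _ _ hi, Pi.single_apply, if_neg]
      rintro rfl
      exact hi hj
  conv_lhs => rw [hM]
  rw [LinearMap.det_comp, hdet, mul_comm]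

/-- If some cycle of `π` misses `P'`, then a label that is constant on this cycle and zero elsewhere
solves the equations. -/
theorem det_eq_zero_of_missed_cycle [Finite P] (hs : ∃ p, ∀ b, ¬ π.SameCycle p (ι b))
    (R : ((P' → ℝ) × (P' → ℝ)) →ₗ[ℝ] (P' → ℝ)) (L : (P → ℝ) →ₗ[ℝ] (P → ℝ))
    (hr : ∀ x b, L x (ι b) = R (x ∘ ι, x ∘ π.symm ∘ ι) b)
    (hn : ∀ x p, p ∉ Set.range ι → L x p = x p - x (π.symm p)) :
    LinearMap.det L = 0 := by
  classical
  obtain ⟨p, hp⟩ := hs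
  let x : P → ℝ := fun q => if π.SameCycle p q then 1 else 0
  have hx : ∀ q, x (π.symm q) = x q := by
    intro q
    have : π.SameCycle p (π.symm q) ↔ π.SameCycle p q := by
      rw [← Equiv.Perm.sameCycle_apply_right, Equiv.apply_symm_apply]
    simp only [x, this]
  have h0 : x ∘ ι = 0 := funext fun b => if_neg (hp b)
  have h1 : x ∘ π.symm ∘ ι = 0 := funext fun b => by
    simp only [Function.comp_apply, hx]
    exact if_neg (hp b)
  have hLx : L x = 0 := by
    ext q
    by_cases hq : q ∈ Set.range ι
    · obtain ⟨b, rfl⟩ := hq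
      rw [hr, h0, h1]
      exact congrFun (map_zero R) b
    · rw [hn x q hq, hx, sub_self]
      rfl
  by_contra hd
  have : x = 0 := by
    have hk := (LinearMap.isUnit_iff_isUnit_det L).2 (isUnit_iff_ne_zero.2 hd)
    exact ((Module.End.isUnit_iff L).1 hk).1 (by rw [hLx, map_zero])
  have := congrFun this p
  simp [x, Equiv.Perm.SameCycle.refl] at this

end FirstReturn

namespace DiagramData

/-! ### Alexander numbering of a planar diagram -/

variable (D : DiagramData)

theorem other_other (p : D.Passage) : D.other (D.other p) = p := by
  simp [other]

theorem otherGoesLeftToRight_other (p : D.Passage) :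
    D.otherGoesLeftToRight (D.other p) = !D.otherGoesLeftToRight p := by
  obtain ⟨c | v, b⟩ := p
  · by_cases h : D.sign c = 1 <;> simp [other, otherGoesLeftToRight, h]
  · simp [other, otherGoesLeftToRight]

/-- The labels that a function on the faces puts on the four edges at a crossing, where `q` is the
passage for which the other strand goes from the left to the right. -/
theorem face_label_eq {β : Type} {g : D.Dart → β} (hg : ∀ d, g (D.faceNext d) = g d)
    {q : D.Passage} (hq : D.otherGoesLeftToRight q = true) :
    g (D.next.symm q, true) = g (D.next.symm (D.other q), false) ∧
    g (D.next.symm (D.other q), true) = g (q, true) ∧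
    g (q, false) = g (D.other q, true) ∧
    g (D.other q, false) = g (D.next.symm q, false) := by
  have hq' : D.otherGoesLeftToRight (D.other q) = false := by
    rw [otherGoesLeftToRight_other, hq, Bool.not_true]
  refine ⟨?_, ?_, ?_, ?_⟩
  · rw [← hg (D.next.symm q, true)]
    simp [faceNext, hq]
  · rw [← hg (D.next.symm (D.other q), true)]
    simp [faceNext, hq', other_other]
  · rw [← hg (q, false)]
    simp [faceNext, hq]
  · rw [← hg (D.other q, false)]
    simp [faceNext, hq', other_other]

theorem exists_otherGoesLeftToRight (p : D.Passage) :
    ∃ q, D.otherGoesLeftToRight q = true ∧ (p = q ∨ p = D.other q) := by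
  cases h : D.otherGoesLeftToRight p
  · exact ⟨D.other p, by rw [otherGoesLeftToRight_other, h, Bool.not_false],
      .inr (other_other D p).symm⟩
  · exact ⟨p, h, .inl rfl⟩

/-- Two crossings that are joined by an edge lie on the same connected component. -/
abbrev PieceRel (x y : D.Crossing) : Prop := ∃ a b : Bool, D.next (x, a) = (y, b)

theorem eq_of_quot_eq {β : Type} {h : D.Crossing → β}
    (hh : ∀ p : D.Passage, h p.1 = h (D.next p).1) {x y : D.Crossing}
    (hxy : Quot.mk D.PieceRel x = Quot.mk _ y) : h x = h y := by
  refine congrArg (Quot.lift h ?_) hxy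
  rintro x y ⟨a, b, hab⟩
  rw [hh (x, a), hab]

/-- A bound for the kernel of `d` if each `f` in it restricts, along `φ`, to a function that determines
`f` and is constant on the connected components. -/
theorem finrank_ker_le {W : Type} [Finite W] {U : Type} [Finite U]
    (d : (W → ℚ) →ₗ[ℚ] (U → ℚ)) (φ : D.Crossing → W)
    (h0 : ∀ f, d f = 0 → ∀ p : D.Passage, f (φ p.1) = f (φ (D.next p).1))
    (h1 : ∀ f, d f = 0 → (∀ x, f (φ x) = 0) → f = 0) :
    Module.finrank ℚ (LinearMap.ker d) ≤ D.numPieces := by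
  have : Finite (Quot D.PieceRel) := Quot.finite _
  have := Fintype.ofFinite (Quot D.PieceRel)
  let T : (W → ℚ) →ₗ[ℚ] (Quot D.PieceRel → ℚ) := LinearMap.funLeft ℚ ℚ fun q => φ q.out
  have hT : Function.Injective (T.domRestrict (LinearMap.ker d)) := by
    rw [← LinearMap.ker_eq_bot, LinearMap.ker_eq_bot']
    rintro ⟨f, hf⟩ hTf
    have hf' : d f = 0 := hf
    refine Subtype.ext (h1 f hf' fun x => ?_)
    have e : f (φ (Quot.mk D.PieceRel x).out) = 0 := congrFun hTf (Quot.mk _ x)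
    rw [← e]
    exact D.eq_of_quot_eq (h := fun x => f (φ x)) (h0 f hf') (Quot.out_eq _).symm
  have := LinearMap.finrank_le_finrank_of_injective hT
  rwa [Module.finrank_fintype_fun_eq_card, ← Nat.card_eq_fintype_card] at this

/-- The incidence matrix of edges and crossings: the edge that leaves `e` starts at the crossing of `e`
and ends at the crossing of `D.next e`. The kernel of the transpose consists of the flows on the edges. -/
def boundaryMatrix : Matrix D.Passage D.Crossing ℚ :=
  Matrix.of fun e v => (if v = e.1 then 1 else 0) - (if v = (D.next e).1 then 1 else 0)

theorem boundaryMatrix_mulVec (h : D.Crossing → ℚ) (e : D.Passage) :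
    D.boundaryMatrix.mulVec h e = h e.1 - h (D.next e).1 := by
  simp [boundaryMatrix, Matrix.mulVec, dotProduct, sub_mul, Finset.sum_sub_distrib]

theorem boundaryMatrix_transpose_mulVec (c : D.Passage → ℚ) (v : D.Crossing) :
    D.boundaryMatrix.transpose.mulVec c v =
      ∑ b : Bool, (c (v, b) - c (D.next.symm (v, b))) := by
  have h1 : ∀ f : D.Passage → ℚ,
      ∑ e : D.Passage, (if v = e.1 then 1 else 0) * f e = ∑ b : Bool, f (v, b) := by
    intro f
    rw [Fintype.sum_prod_type]
    simp
  have h2 := (Equiv.sum_comp D.next fun e =>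
    (if v = e.1 then 1 else 0) * c (D.next.symm e)).trans (h1 fun e => c (D.next.symm e))
  simp only [Equiv.symm_apply_apply] at h2
  simp only [boundaryMatrix, Matrix.mulVec, dotProduct, Matrix.transpose_apply, Matrix.of_apply,
    sub_mul, Finset.sum_sub_distrib, h1, h2]

/-- The faces, as the boundary cycles of darts. -/
abbrev Face : Type := Quot fun a b : D.Dart => D.faceNext a = b

/-- The coboundary of a function on the faces: on each edge, the value on the left minus the value
on the right. -/
def faceCoboundary : (D.Face → ℚ) →ₗ[ℚ] (D.Passage → ℚ) where
  toFun f e := f (Quot.mk _ (e, true)) - f (Quot.mk _ (e, false))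
  map_add' f g := by
    ext e
    simp only [Pi.add_apply]
    ring
  map_smul' a f := by
    ext e
    simp only [Pi.smul_apply, smul_eq_mul, RingHom.id_apply]
    ring

theorem faceCoboundary_apply (f : D.Face → ℚ) (e : D.Passage) :
    D.faceCoboundary f e = f (Quot.mk _ (e, true)) - f (Quot.mk _ (e, false)) := rfl

theorem face_mk_invariant {β : Type} (f : D.Face → β) (d : D.Dart) :
    f (Quot.mk _ (D.faceNext d)) = f (Quot.mk _ d) :=
  congrArg f (Quot.sound (r := fun a b : D.Dart => D.faceNext a = b) rfl).symm

/-- On a planar diagram, every flow on the edges is the coboundary of a function on the faces: one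
space contains the other, and Euler's formula says that the dimensions agree. -/
theorem range_faceCoboundary (hD : D.IsPlanar) :
    LinearMap.range D.faceCoboundary = LinearMap.ker D.boundaryMatrix.transpose.mulVecLin := by
  have : Finite D.Face := Quot.finite _
  have := Fintype.ofFinite D.Face
  apply Submodule.eq_of_le_of_finrank_le
  · rintro _ ⟨f, rfl⟩
    rw [LinearMap.mem_ker]
    ext v
    obtain ⟨q, hq, hqv⟩ := D.exists_otherGoesLeftToRight (v, true)
    obtain ⟨e1, e2, e3, e4⟩ := D.face_label_eq (g := fun d => f (Quot.mk _ d))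
      (D.face_mk_invariant f) hq
    have hsum : ∀ F : D.Passage → ℚ, ∑ b : Bool, F (v, b) = F q + F (D.other q) := by
      intro F
      rcases hqv with rfl | h
      · simp [other]
      · rw [← D.other_other q, ← h]
        simp [other, add_comm]
    rw [Matrix.mulVecLin_apply, boundaryMatrix_transpose_mulVec,
      hsum fun p => D.faceCoboundary f p - D.faceCoboundary f (D.next.symm p)]
    simp only [faceCoboundary_apply, Pi.zero_apply] at *
    linarith
  · have k1 : Module.finrank ℚ (LinearMap.ker D.boundaryMatrix.mulVecLin) ≤ D.numPieces := by
      refine D.finrank_ker_le _ id (fun f hf p => ?_) (fun f _ h => funext h)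
      have := congrFun hf p
      rw [Matrix.mulVecLin_apply, boundaryMatrix_mulVec] at this
      exact sub_eq_zero.1 this
    have k2 : Module.finrank ℚ (LinearMap.ker D.faceCoboundary) ≤ D.numPieces := by
      have key : ∀ f, D.faceCoboundary f = 0 → ∀ q, D.otherGoesLeftToRight q = true →
          (∀ b, f (Quot.mk _ (D.next.symm q, b)) = f (Quot.mk _ (q, true))) ∧
          (∀ b, f (Quot.mk _ (D.next.symm (D.other q), b)) = f (Quot.mk _ (q, true))) ∧
          (∀ b, f (Quot.mk _ (q, b)) = f (Quot.mk _ (q, true))) ∧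
          (∀ b, f (Quot.mk _ (D.other q, b)) = f (Quot.mk _ (q, true))) := by
        intro f hf q hq
        obtain ⟨e1, e2, e3, e4⟩ := D.face_label_eq (g := fun d => f (Quot.mk _ d))
          (D.face_mk_invariant f) hq
        have h1 := congrFun hf q
        have h2 := congrFun hf (D.other q)
        have h3 := congrFun hf (D.next.symm q)
        have h4 := congrFun hf (D.next.symm (D.other q))
        simp only [faceCoboundary_apply, Pi.zero_apply] at *
        refine ⟨?_, ?_, ?_, ?_⟩ <;> rintro (_ | _) <;> linarith
      have key' : ∀ f, D.faceCoboundary f = 0 → ∀ p : D.Passage,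
          (∀ b, f (Quot.mk _ (D.next.symm p, b)) = f (Quot.mk _ ((p.1, true), true))) ∧
          (∀ b, f (Quot.mk _ (p, b)) = f (Quot.mk _ ((p.1, true), true))) := by
        intro f hf p
        obtain ⟨q, hq, h⟩ := D.exists_otherGoesLeftToRight p
        obtain ⟨h1, h2, h3, h4⟩ := key f hf q hq
        have h5 : f (Quot.mk _ ((p.1, true), true)) = f (Quot.mk _ (q, true)) := by
          have hp : p.1 = q.1 := by rcases h with rfl | rfl <;> rfl
          rw [hp]
          obtain ⟨x, _ | _⟩ := q
          · exact h4 true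
          · rfl
        rw [h5]
        rcases h with rfl | rfl
        · exact ⟨h1, h3⟩
        · exact ⟨h2, h4⟩
      refine D.finrank_ker_le _ (fun x => Quot.mk _ ((x, true), true)) (fun f hf p => ?_)
        (fun f hf h => ?_)
      · have h1 := (key' f hf (D.next p)).1 true
        rw [Equiv.symm_apply_apply] at h1
        rw [← h1, (key' f hf p).2]
      · ext ⟨p, b⟩
        exact ((key' f hf p).2 b).trans (h p.1)
    have r1 := LinearMap.finrank_range_add_finrank_ker D.boundaryMatrix.mulVecLin
    have r2 := LinearMap.finrank_range_add_finrank_ker D.boundaryMatrix.transpose.mulVecLin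
    have r3 := LinearMap.finrank_range_add_finrank_ker D.faceCoboundary
    have r4 : Module.finrank ℚ (LinearMap.range D.boundaryMatrix.transpose.mulVecLin) =
      Module.finrank ℚ (LinearMap.range D.boundaryMatrix.mulVecLin) :=
      Matrix.rank_transpose D.boundaryMatrix
    rw [Module.finrank_fintype_fun_eq_card] at r1 r2 r3
    have r5 : Fintype.card D.Face = Fintype.card D.Crossing + 2 * D.numPieces := by
      rw [← Nat.card_eq_fintype_card]
      exact hD
    have r6 : Fintype.card D.Passage = Fintype.card D.Crossing * 2 := by
      rw [Fintype.card_prod, Fintype.card_bool]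
    omega

/-- An Alexander numbering: `I p` numbers the region on the left of the edge that leaves `p`, and
numbers go down by one when an edge is crossed from its left to its right. -/
theorem exists_alexander_numbering (hD : D.IsPlanar) :
    ∃ I : D.Passage → ℤ, ∀ q, D.otherGoesLeftToRight q = true →
      I q = I (D.next.symm q) + 1 ∧ I (D.other q) = I (D.next.symm q) ∧
        I (D.next.symm (D.other q)) = I (D.next.symm q) + 1 := by
  have h1 : (fun _ => 1 : D.Passage → ℚ) ∈ LinearMap.range D.faceCoboundary := by
    rw [D.range_faceCoboundary hD, LinearMap.mem_ker]
    ext v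
    rw [Matrix.mulVecLin_apply, boundaryMatrix_transpose_mulVec]
    simp
  obtain ⟨f, hf⟩ := h1
  -- the values of `f` may be fractional, but its differences are integers, so that `⌊f⌋` will do
  have hfl : ∀ p : D.Passage,
      ⌊f (Quot.mk _ (p, true))⌋ = ⌊f (Quot.mk _ (p, false))⌋ + 1 := by
    intro p
    have := congrFun hf p
    rw [faceCoboundary_apply] at this
    rw [← Int.floor_add_one]
    congr 1
    linarith
  refine ⟨fun p => ⌊f (Quot.mk _ (p, true))⌋, fun q hq => ?_⟩
  obtain ⟨e1, e2, e3, e4⟩ := D.face_label_eq (g := fun d => ⌊f (Quot.mk _ d)⌋)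
    (D.face_mk_invariant fun x => ⌊f x⌋) hq
  have h1 := hfl q
  have h2 := hfl (D.other q)
  have h3 := hfl (D.next.symm q)
  have h4 := hfl (D.next.symm (D.other q))
  dsimp only at *
  omega

end DiagramData

namespace DiagramData

/-! ### The colouring determinant -/

variable (D : DiagramData)

/-- The equation at each passage in terms of the labels `z.1` of the outgoing and `z.2` of the
incoming edges. At a classical crossing the label is kept on the upper strand, and it is reflected
in the label of the upper strand on the lower one (Fox colouring, in a form that is symmetric under
reversal of the strands). At a virtual crossing it is multiplied by `u⁻¹` or by `u`. -/
noncomputable def coloringRule (u : ℝ) :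
    ((D.Passage → ℝ) × (D.Passage → ℝ)) →ₗ[ℝ] (D.Passage → ℝ) where
  toFun z
    | (Sum.inl c, true) => z.1 (D.overpass c) - z.2 (D.overpass c)
    | (Sum.inl c, false) =>
        z.1 (D.underpass c) + z.2 (D.underpass c) - z.1 (D.overpass c) - z.2 (D.overpass c)
    | (Sum.inr v, true) => z.1 (Sum.inr v, true) - u⁻¹ * z.2 (Sum.inr v, true)
    | (Sum.inr v, false) => z.1 (Sum.inr v, false) - u * z.2 (Sum.inr v, false)
  map_add' z w := by
    ext ⟨c | v, _ | _⟩ <;> simp <;> ring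
  map_smul' a z := by
    ext ⟨c | v, _ | _⟩ <;> simp <;> ring

/-- Equations `R (outgoing labels, incoming labels)` as an endomorphism of the edge labels; the label
of the edge that leaves `p` is `x p`. -/
def edgeMap {P : Type} (π : Equiv.Perm P)
    (R : ((P → ℝ) × (P → ℝ)) →ₗ[ℝ] (P → ℝ)) : (P → ℝ) →ₗ[ℝ] (P → ℝ) :=
  R ∘ₗ LinearMap.prod LinearMap.id (LinearMap.funLeft ℝ ℝ π.symm)

/-- The colouring equations of `D`, one for each passage, in the labels of the edges. -/
noncomputable def coloringMap (u : ℝ) : (D.Passage → ℝ) →ₗ[ℝ] (D.Passage → ℝ) :=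
  edgeMap D.next (D.coloringRule u)

theorem coloringMap_over (u : ℝ) (x : D.Passage → ℝ) (c : D.C) :
    D.coloringMap u x (D.overpass c) = x (D.overpass c) - x (D.next.symm (D.overpass c)) := rfl

theorem coloringMap_under (u : ℝ) (x : D.Passage → ℝ) (c : D.C) :
    D.coloringMap u x (D.underpass c) =
      x (D.underpass c) + x (D.next.symm (D.underpass c)) - x (D.overpass c) -
        x (D.next.symm (D.overpass c)) := rfl

theorem coloringMap_virtual_true (u : ℝ) (x : D.Passage → ℝ) (v : D.V) :
    D.coloringMap u x (Sum.inr v, true) =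
      x (Sum.inr v, true) - u⁻¹ * x (D.next.symm (Sum.inr v, true)) := rfl

theorem coloringMap_virtual_false (u : ℝ) (x : D.Passage → ℝ) (v : D.V) :
    D.coloringMap u x (Sum.inr v, false) =
      x (Sum.inr v, false) - u * x (D.next.symm (Sum.inr v, false)) := rfl

/-- The colouring determinant. A closed curve without crossings carries an arbitrary label, so
its presence makes the determinant vanish. -/
noncomputable def coloringDet (u : ℝ) : ℝ :=
  if D.loops = 0 then LinearMap.det (D.coloringMap u) else 0

/-- The colouring determinants agree up to a constant factor. The factor must not depend on `u`: it is
the degree of the determinant in `u⁻¹` that is to be compared with the number of virtual crossings. -/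
def ProportionalDet (D D' : DiagramData) : Prop :=
  ∃ c : ℝ, c ≠ 0 ∧ ∀ u : ℝ, u ≠ 0 → D.coloringDet u = c * D'.coloringDet u

variable {D} {D' : DiagramData}

theorem ProportionalDet.symm (h : ProportionalDet D D') : ProportionalDet D' D := by
  obtain ⟨c, hc, h⟩ := h
  exact ⟨c⁻¹, inv_ne_zero hc, fun u hu => by rw [h u hu, inv_mul_cancel_left₀ hc]⟩

theorem ProportionalDet.trans {D'' : DiagramData} (h : ProportionalDet D D')
    (h' : ProportionalDet D' D'') : ProportionalDet D D'' := by
  obtain ⟨c, hc, h⟩ := h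
  obtain ⟨c', hc', h'⟩ := h'
  exact ⟨c * c', mul_ne_zero hc hc', fun u hu => by rw [h u hu, h' u hu, mul_assoc]⟩

/-- Changes of the labels and of the equations that do not involve `u` multiply the determinant by a
constant. -/
theorem det_eq_const_mul_of_intertwine {ι : Type} [Finite ι] {A B : ℝ → (ι → ℝ) →ₗ[ℝ] (ι → ℝ)}
    (E F : (ι → ℝ) →ₗ[ℝ] (ι → ℝ)) (hE : Function.Injective E) (hF : Function.Injective F)
    (h : ∀ u x, A u (E x) = F (B u x)) :
    ∃ c : ℝ, c ≠ 0 ∧ ∀ u, LinearMap.det (A u) = c * LinearMap.det (B u) := by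
  have hne : ∀ G : (ι → ℝ) →ₗ[ℝ] (ι → ℝ), Function.Injective G → LinearMap.det G ≠ 0 :=
    fun G hG => (LinearEquiv.isUnit_det' (LinearEquiv.ofInjectiveEndo G hG)).ne_zero
  refine ⟨LinearMap.det F / LinearMap.det E, div_ne_zero (hne F hF) (hne E hE), fun u => ?_⟩
  have : A u ∘ₗ E = F ∘ₗ B u := LinearMap.ext fun x => h u x
  have h2 := congrArg LinearMap.det this
  rw [LinearMap.det_comp, LinearMap.det_comp] at h2
  have := hne E hE
  field_simp
  linarith

/-! ### First and second Reidemeister moves -/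

/-- The colouring equations with those at the crossings of `S` replaced by `outgoing = incoming`. -/
noncomputable def mutedMap (D : DiagramData) (S : Set D.C) (u : ℝ) :
    (D.Passage → ℝ) →ₗ[ℝ] (D.Passage → ℝ) where
  toFun x p :=
    open Classical in
    if ∃ c ∈ S, p.1 = Sum.inl c then x p - x (D.next.symm p) else D.coloringMap u x p
  map_add' x y := by
    ext p
    simp only [map_add, Pi.add_apply]
    split_ifs <;> ring
  map_smul' a x := by
    ext p
    simp only [map_smul, Pi.smul_apply, smul_eq_mul, RingHom.id_apply]
    split_ifs <;> ring

theorem mutedMap_of_mem {S : Set D.C} {c : D.C} (hc : c ∈ S) (u : ℝ) (x : D.Passage → ℝ)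
    (b : Bool) : D.mutedMap S u x (Sum.inl c, b) =
      x (Sum.inl c, b) - x (D.next.symm (Sum.inl c, b)) :=
  if_pos ⟨c, hc, rfl⟩

theorem mutedMap_of_not_mem {S : Set D.C} {p : D.Passage} (hp : ¬ ∃ c ∈ S, p.1 = Sum.inl c)
    (u : ℝ) (x : D.Passage → ℝ) : D.mutedMap S u x p = D.coloringMap u x p :=
  if_neg hp

/-- The determinant is preserved when classical crossings are removed whose equations can be
transformed, by operations that do not involve `u`, into those saying that labels do not change
there. If a component loses its last crossing, then both determinants vanish. -/
theorem IsErasure.proportionalDet {S : Set D.C} (h : D.IsErasure D' S)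
    (E F : (D.Passage → ℝ) →ₗ[ℝ] (D.Passage → ℝ))
    (hE : Function.Injective E) (hF : Function.Injective F)
    (hEF : ∀ u x, D.coloringMap u (E x) = F (D.mutedMap S u x)) : ProportionalDet D D' := by
  obtain ⟨ι, e, hS, hsign, hret, hcomp⟩ := h
  set j : D'.Passage → D.Passage := fun p => (Sum.map ι e p.1, p.2) with hj
  have hjinj : Function.Injective j := by
    rintro ⟨x, b⟩ ⟨y, b'⟩ hxy
    simp only [hj, Prod.mk.injEq] at hxy
    rw [Sum.map_injective.2 ⟨ι.injective, e.injective⟩ hxy.1, hxy.2]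
  have hrange : ∀ p, p ∉ Set.range j ↔ ∃ c ∈ S, p.1 = Sum.inl c := by
    intro p
    constructor
    · obtain ⟨c | v, b⟩ := p
      · intro hp
        refine ⟨c, ?_, rfl⟩
        by_contra hc
        rw [← Set.mem_compl_iff, ← hS] at hc
        obtain ⟨c', rfl⟩ := hc
        exact hp ⟨(Sum.inl c', b), rfl⟩
      · intro hp
        exact absurd ⟨(Sum.inr (e.symm v), b), by simp [hj]⟩ hp
    · rintro ⟨c, hc, hp⟩ ⟨⟨c' | v, b⟩, rfl⟩
      · have : ι c' = c := by simpa [hj] using hp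
        have h2 : ι c' ∈ Sᶜ := hS ▸ ⟨c', rfl⟩
        exact h2 (this ▸ hc)
      · simp [hj] at hp
  have hn : ∀ u x p, p ∉ Set.range j → D.mutedMap S u x p = x p - x (D.next.symm p) :=
    fun u x p hp => if_pos ((hrange p).1 hp)
  have hr : ∀ u x b, D.mutedMap S u x (j b) =
      D'.coloringRule u (x ∘ j, x ∘ D.next.symm ∘ j) b := by
    intro u x b
    rw [mutedMap_of_not_mem (fun h => (hrange _).2 h ⟨b, rfl⟩)]
    obtain ⟨c | v, _ | _⟩ := b <;> rfl
  obtain ⟨c, hc, hdet⟩ := det_eq_const_mul_of_intertwine E F hE hF hEF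
  simp only [numComponents] at hcomp
  rcases hret.numOrbits hjinj with ⟨hs, he⟩ | ⟨hs, hlt⟩
  · obtain ⟨c', hc', h'⟩ := hret.exists_det_eq hjinj hs
    refine ⟨c * c', mul_ne_zero hc hc', fun u _ => ?_⟩
    have hl : D'.loops = D.loops := by omega
    simp only [coloringDet, hl]
    split_ifs
    · rw [hdet u, h' (D'.coloringRule u) _ (D'.coloringMap u) (hr u) (hn u) fun x => rfl,
        mul_assoc]
    · simp
  · refine ⟨1, one_ne_zero, fun u _ => ?_⟩
    have hl : D'.loops ≠ 0 := by omega
    have h0 := det_eq_zero_of_missed_cycle hs (D'.coloringRule u) _ (hr u) (hn u)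
    simp [coloringDet, hl, hdet, h0]

/-- Replace the label of `p` by a linear function of all labels. -/
noncomputable def replaceLabel {P : Type} [DecidableEq P] (p : P) (φ : (P → ℝ) →ₗ[ℝ] ℝ) :
    (P → ℝ) →ₗ[ℝ] (P → ℝ) where
  toFun x := Function.update x p (φ x)
  map_add' x y := by
    ext q
    by_cases hq : q = p
    · subst hq; simp
    · simp [hq]
  map_smul' a x := by
    ext q
    by_cases hq : q = p
    · subst hq; simp
    · simp [hq]

theorem replaceLabel_same {P : Type} [DecidableEq P] (p : P) (φ : (P → ℝ) →ₗ[ℝ] ℝ) (x : P → ℝ) :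
    replaceLabel p φ x p = φ x := by
  simp [replaceLabel]

theorem replaceLabel_of_ne {P : Type} [DecidableEq P] {p q : P} (h : q ≠ p)
    (φ : (P → ℝ) →ₗ[ℝ] ℝ) (x : P → ℝ) : replaceLabel p φ x q = x q := by
  simp [replaceLabel, h]

theorem replaceLabel_injective {P : Type} [DecidableEq P] (p : P) (φ : (P → ℝ) →ₗ[ℝ] ℝ)
    (h : ∀ x, φ x = 0 → (∀ q, q ≠ p → x q = 0) → x p = 0) :
    Function.Injective (replaceLabel p φ) := by
  rw [← LinearMap.ker_eq_bot, LinearMap.ker_eq_bot']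
  intro x hx
  have h1 : ∀ q, q ≠ p → x q = 0 := fun q hq => by
    rw [← replaceLabel_of_ne hq φ x, hx]
    rfl
  ext q
  by_cases hq : q = p
  · subst hq
    exact h x (by rw [← replaceLabel_same q φ x, hx]; rfl) h1
  · exact h1 q hq

/-- The label at `p` as a linear function. -/
abbrev label {P : Type} (p : P) : (P → ℝ) →ₗ[ℝ] ℝ := LinearMap.proj p

theorem overpass_ne_underpass (c d : D.C) : D.overpass c ≠ D.underpass d := by
  simp [overpass, underpass]

/-- Every passage is an overpass or an underpass at a crossing of `S`, or at a crossing not in `S`. -/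
theorem passage_cases (S : Set D.C) (p : D.Passage) :
    (∃ c ∈ S, p = D.overpass c) ∨ (∃ c ∈ S, p = D.underpass c) ∨ ¬ ∃ c ∈ S, p.1 = Sum.inl c := by
  by_cases h : ∃ c ∈ S, p.1 = Sum.inl c
  · obtain ⟨c, hc, hp⟩ := h
    obtain ⟨x, _ | _⟩ := p
    · exact .inr (.inl ⟨c, hc, by rw [underpass, ← hp]⟩)
    · exact .inl ⟨c, hc, by rw [overpass, ← hp]⟩
  · exact .inr (.inr h)

/-- At a curl, the equation of the underpass is, up to sign, the sum of the two muted equations. -/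
theorem Reidemeister1.proportionalDet (h : D.Reidemeister1 D') : ProportionalDet D D' := by
  obtain ⟨c, b, hb, h⟩ := h
  have hou : D.overpass c ≠ D.underpass c := overpass_ne_underpass c c
  have hmo : ∀ u x, D.mutedMap {c} u x (D.overpass c) =
      x (D.overpass c) - x (D.next.symm (D.overpass c)) :=
    fun u x => mutedMap_of_mem (Set.mem_singleton c) u x true
  have hmu : ∀ u x, D.mutedMap {c} u x (D.underpass c) =
      x (D.underpass c) - x (D.next.symm (D.underpass c)) :=
    fun u x => mutedMap_of_mem (Set.mem_singleton c) u x false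
  -- it suffices to express the equation at the underpass by the two muted equations
  have key : ∀ s : ℝ, s ≠ 0 → (∀ x : D.Passage → ℝ,
      x (D.underpass c) + x (D.next.symm (D.underpass c)) - x (D.overpass c) -
        x (D.next.symm (D.overpass c)) =
      s * (x (D.underpass c) - x (D.next.symm (D.underpass c))) +
        s * (x (D.overpass c) - x (D.next.symm (D.overpass c)))) → ProportionalDet D D' := by
    intro s hs hx
    refine h.proportionalDet LinearMap.id
      (replaceLabel (D.underpass c) (s • label (D.underpass c) + s • label (D.overpass c)))
      Function.injective_id ?_ fun u x => ?_
    · refine replaceLabel_injective _ _ fun x h0 h1 => ?_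
      have h2 : s * x (D.underpass c) + s * x (D.overpass c) = 0 := h0
      rw [h1 _ hou] at h2
      simpa [hs] using h2
    · ext p
      rw [LinearMap.id_apply]
      rcases passage_cases {c} p with ⟨d, rfl, rfl⟩ | ⟨d, rfl, rfl⟩ | hp
      · rw [replaceLabel_of_ne hou, hmo, coloringMap_over]
      · rw [replaceLabel_same]
        simp only [LinearMap.add_apply, LinearMap.smul_apply, LinearMap.proj_apply, smul_eq_mul]
        rw [hmo, hmu, coloringMap_under, hx]
      · rw [replaceLabel_of_ne, mutedMap_of_not_mem hp]
        rintro rfl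
        exact hp ⟨c, rfl, rfl⟩
  cases b
  · have e : D.next.symm (D.overpass c) = D.underpass c := by
      rw [Equiv.symm_apply_eq]
      exact hb.symm
    exact key (-1) (by norm_num) fun x => by rw [e]; ring
  · have e : D.next.symm (D.underpass c) = D.overpass c := by
      rw [Equiv.symm_apply_eq]
      exact hb.symm
    exact key 1 one_ne_zero fun x => by rw [e]; ring

/-- The equation at a passage only involves the labels of the edges at its crossing. -/
theorem coloringMap_congr (u : ℝ) {x y : D.Passage → ℝ} {p : D.Passage}
    (h1 : ∀ b, x (p.1, b) = y (p.1, b))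
    (h2 : ∀ b, x (D.next.symm (p.1, b)) = y (D.next.symm (p.1, b))) :
    D.coloringMap u x p = D.coloringMap u y p := by
  obtain ⟨c | v, b⟩ := p
  · have a1 := h1 true
    have a2 := h1 false
    have a3 := h2 true
    have a4 := h2 false
    cases b
    · change D.coloringMap u x (D.underpass c) = D.coloringMap u y (D.underpass c)
      rw [coloringMap_under, coloringMap_under]
      simp only [overpass, underpass] at *
      rw [a1, a2, a3, a4]
    · change D.coloringMap u x (D.overpass c) = D.coloringMap u y (D.overpass c)
      rw [coloringMap_over, coloringMap_over]
      simp only [overpass] at *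
      rw [a1, a3]
  · have a1 := h1 b
    have a3 := h2 b
    cases b
    · rw [coloringMap_virtual_false, coloringMap_virtual_false]
      simp only at *
      rw [a1, a3]
    · rw [coloringMap_virtual_true, coloringMap_virtual_true]
      simp only at *
      rw [a1, a3]

/-- Changing the label of an edge between two crossings of `S` does not affect the equations at the
other crossings. -/
theorem coloringMap_replaceLabel {S : Set D.C} {q : D.Passage} (hq : ∃ c ∈ S, q.1 = Sum.inl c)
    (hq' : ∃ c ∈ S, (D.next q).1 = Sum.inl c) {p : D.Passage}
    (hp : ¬ ∃ c ∈ S, p.1 = Sum.inl c) (u : ℝ) (φ : (D.Passage → ℝ) →ₗ[ℝ] ℝ)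
    (x : D.Passage → ℝ) :
    D.coloringMap u (replaceLabel q φ x) p = D.coloringMap u x p := by
  refine coloringMap_congr u (fun b => replaceLabel_of_ne ?_ _ _)
    (fun b => replaceLabel_of_ne ?_ _ _)
  · rintro rfl
    exact hp hq
  · rintro rfl
    rw [Equiv.apply_symm_apply] at hq'
    exact hp hq'

/-- At a bigon, reflecting the label of its lower edge in the label of the upper strand mutes the
equations. -/
theorem Reidemeister2.proportionalDet (h : D.Reidemeister2 D') : ProportionalDet D D' := by
  obtain ⟨c, d, hsign, hover, hunder, h⟩ := h
  have hcd : c ≠ d := by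
    rintro rfl
    rcases Int.units_eq_one_or (D.sign c) with h1 | h1 <;> simp [h1] at hsign
  have hdc := hcd.symm
  have hc : c ∈ ({c, d} : Set D.C) := by simp
  have hd : d ∈ ({c, d} : Set D.C) := by simp
  have hio : D.next.symm (D.overpass d) = D.overpass c := by rw [← hover, Equiv.symm_apply_apply]
  have mo : ∀ a ∈ ({c, d} : Set D.C), ∀ u x, D.mutedMap {c, d} u x (D.overpass a) =
      x (D.overpass a) - x (D.next.symm (D.overpass a)) :=
    fun a ha u x => mutedMap_of_mem ha u x true
  have mu : ∀ a ∈ ({c, d} : Set D.C), ∀ u x, D.mutedMap {c, d} u x (D.underpass a) =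
      x (D.underpass a) - x (D.next.symm (D.underpass a)) :=
    fun a ha u x => mutedMap_of_mem ha u x false
  have n3 : ∀ a b, D.overpass a ≠ D.underpass b := overpass_ne_underpass
  -- the edge of the lower strand leads from `a` to `b`
  have key : ∀ a b : D.C, ({a, b} : Set D.C) = {c, d} → a ≠ b →
      D.next (D.underpass a) = D.underpass b →
      ∀ φ ψ : (D.Passage → ℝ) →ₗ[ℝ] ℝ, (∀ x, φ x = -x (D.underpass a) + x (D.overpass a) +
        x (D.next.symm (D.overpass a))) → (∀ x, (∀ q, q ≠ D.underpass b → x q = 0) →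
        ψ x = x (D.underpass b)) →
      (∀ u x, x (D.underpass b) + (-x (D.underpass a) + x (D.overpass a) +
        x (D.next.symm (D.overpass a))) - x (D.overpass b) - x (D.next.symm (D.overpass b)) =
          ψ (D.mutedMap {c, d} u x)) → ProportionalDet D D' := by
    intro a b hab hne hnext φ ψ hφ hψ hrow
    have ha : a ∈ ({c, d} : Set D.C) := hab ▸ by simp
    have hb : b ∈ ({c, d} : Set D.C) := hab ▸ by simp
    have hi : D.next.symm (D.underpass b) = D.underpass a := by
      rw [← hnext, Equiv.symm_apply_apply]
    have hba : D.underpass b ≠ D.underpass a := by simp [underpass, hne.symm]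
    have hia : D.next.symm (D.underpass a) ≠ D.underpass a := by
      intro h
      rw [Equiv.symm_apply_eq, hnext] at h
      exact hba h.symm
    have hio : ∀ e, D.next.symm (D.overpass e) ≠ D.underpass a := by
      intro e h
      rw [Equiv.symm_apply_eq, hnext] at h
      exact n3 _ _ h
    refine h.proportionalDet (replaceLabel (D.underpass a) φ)
      (replaceLabel (D.underpass a) (-label (D.underpass a)) ∘ₗ replaceLabel (D.underpass b) ψ)
      (replaceLabel_injective _ _ fun x h0 h1 => ?_) ?_ fun u x => ?_
    · rw [hφ, h1 _ (n3 _ _), h1 _ (hio a)] at h0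
      linarith
    · rw [LinearMap.coe_comp]
      refine Function.Injective.comp (replaceLabel_injective _ _ fun x h0 h1 => ?_)
        (replaceLabel_injective _ _ fun x h0 h1 => ?_)
      · have : -x (D.underpass a) = 0 := h0
        linarith
      · rw [← hψ x h1, h0]
    · ext p
      rw [LinearMap.comp_apply]
      have hcases : p = D.underpass a ∨ p = D.underpass b ∨
          (∃ e ∈ ({c, d} : Set D.C), p = D.overpass e) ∨
          ¬ ∃ e ∈ ({c, d} : Set D.C), p.1 = Sum.inl e := by
        rcases passage_cases {c, d} p with hp | ⟨e, he, rfl⟩ | hp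
        · exact .inr (.inr (.inl hp))
        · rw [← hab] at he
          rcases he with rfl | rfl
          · exact .inl rfl
          · exact .inr (.inl rfl)
        · exact .inr (.inr (.inr hp))
      rcases hcases with rfl | rfl | ⟨e, he, rfl⟩ | hp
      · rw [replaceLabel_same, LinearMap.neg_apply, LinearMap.proj_apply,
          replaceLabel_of_ne hba.symm, mu a ha, coloringMap_under, replaceLabel_same,
          replaceLabel_of_ne hia, replaceLabel_of_ne (n3 _ _), replaceLabel_of_ne (hio a), hφ]
        ring
      · rw [replaceLabel_of_ne hba, replaceLabel_same, ← hrow, coloringMap_under, hi,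
          replaceLabel_same, replaceLabel_of_ne hba, replaceLabel_of_ne (n3 _ _),
          replaceLabel_of_ne (hio b), hφ]
      · rw [replaceLabel_of_ne (n3 _ _), replaceLabel_of_ne (n3 _ _), mo e he, coloringMap_over,
          replaceLabel_of_ne (n3 _ _), replaceLabel_of_ne (hio e)]
      · have e1 : p ≠ D.underpass a := by
          rintro rfl
          exact hp ⟨a, ha, rfl⟩
        have e2 : p ≠ D.underpass b := by
          rintro rfl
          exact hp ⟨b, hb, rfl⟩
        rw [replaceLabel_of_ne e1, replaceLabel_of_ne e2, mutedMap_of_not_mem hp,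
          coloringMap_replaceLabel ⟨a, ha, rfl⟩ ⟨b, hb, by rw [hnext]; rfl⟩ hp]
  rcases hunder with hu | hu
  · refine key c d rfl hcd hu
      (-label (D.underpass c) + label (D.overpass c) + label (D.next.symm (D.overpass c)))
      (label (D.underpass d) - label (D.overpass d) - label (D.overpass c))
      (fun x => rfl) (fun x hx => ?_) fun u x => ?_
    · simp [hx _ (n3 _ _)]
    · simp only [LinearMap.sub_apply, LinearMap.proj_apply]
      rw [mu d hd, mo d hd, mo c hc, ← hu, Equiv.symm_apply_apply, hio]
      ring
  · refine key d c (Set.pair_comm d c) hdc hu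
      (-label (D.underpass d) + label (D.overpass d) + label (D.next.symm (D.overpass d)))
      (label (D.underpass c) + label (D.overpass d) + label (D.overpass c))
      (fun x => rfl) (fun x hx => ?_) fun u x => ?_
    · simp [hx _ (n3 _ _)]
    · simp only [LinearMap.add_apply, LinearMap.proj_apply]
      rw [mu c hc, mo d hd, mo c hc, ← hu, Equiv.symm_apply_apply, hio]
      ring

/-! ### Third Reidemeister move -/

theorem swap_mul_swap_mul_swap_apply {P : Type} [DecidableEq P] {a b c d e f : P}
    (h : [a, b, c, d, e, f].Nodup) :
    let σ := Equiv.swap a b * Equiv.swap c d * Equiv.swap e f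
    σ a = b ∧ σ b = a ∧ σ c = d ∧ σ d = c ∧ σ e = f ∧ σ f = e ∧
      ∀ q, q ∉ [a, b, c, d, e, f] → σ q = q := by
  simp only [List.nodup_cons, List.mem_cons, List.not_mem_nil, or_false, not_or,
    List.nodup_nil, not_false_eq_true, and_true] at h
  simp only [Equiv.Perm.mul_apply, List.mem_cons, List.not_mem_nil, or_false, not_or]
  refine ⟨?_, ?_, ?_, ?_, ?_, ?_, ?_⟩ <;> grind

/-- The edge that joins `p` and `q` leads from `m` to `n`; `s` is its orientation as a real number. -/
theorem Joined.cases {o : ℤˣ} {p q : D.Passage} (h : D.Joined o p q) :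
    ∃ (m n : D.Passage) (s : ℝ), D.next m = n ∧
      ((m = p ∧ n = q ∧ s = 1) ∨ (m = q ∧ n = p ∧ s = -1)) := by
  rcases h with ⟨-, h⟩ | ⟨-, h⟩
  · exact ⟨p, q, 1, h, .inl ⟨rfl, rfl, rfl⟩⟩
  · exact ⟨q, p, -1, h, .inr ⟨rfl, rfl, rfl⟩⟩

/-- Three strands form a triangle at the crossings `x`, `y`, `z` as in the third Reidemeister move.
The equations after the move are obtained from those before it by a change of the labels and a
change of the equations that do not involve `u`. -/
theorem exists_det_eq_of_triangle {x y z : D.C} {oT oM oB : ℤˣ}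
    (hxy : x ≠ y) (hxz : x ≠ z) (hyz : y ≠ z)
    (hT : D.Joined oT (D.overpass x) (D.overpass y))
    (hM : D.Joined oM (D.underpass x) (D.overpass z))
    (hB : D.Joined oB (D.underpass y) (D.underpass z))
    (B : ℝ → (D.Passage → ℝ) →ₗ[ℝ] (D.Passage → ℝ))
    (b1 : ∀ u w, B u w (D.overpass x) =
      w (D.overpass x) - w (D.next.symm (D.overpass x)))
    (b2 : ∀ u w, B u w (D.overpass y) =
      w (D.overpass y) - w (D.next.symm (D.overpass y)))
    (b3 : ∀ u w, B u w (D.underpass x) =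
      w (D.underpass x) - w (D.next.symm (D.underpass x)))
    (b4 : ∀ u w, B u w (D.overpass z) =
      w (D.overpass z) + w (D.next.symm (D.overpass z)) - w (D.overpass y) -
        w (D.next.symm (D.overpass y)))
    (b5 : ∀ u w, B u w (D.underpass y) =
      w (D.underpass y) + w (D.next.symm (D.underpass y)) - w (D.underpass x) -
        w (D.next.symm (D.underpass x)))
    (b6 : ∀ u w, B u w (D.underpass z) =
      w (D.underpass z) + w (D.next.symm (D.underpass z)) - w (D.overpass x) -
        w (D.next.symm (D.overpass x)))
    (b7 : ∀ u w p, (¬ ∃ c ∈ ({x, y, z} : Set D.C), p.1 = Sum.inl c) →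
      B u w p = D.coloringMap u w p) :
    ∃ c : ℝ, c ≠ 0 ∧ ∀ u, LinearMap.det (B u) = c * LinearMap.det (D.coloringMap u) := by
  obtain ⟨mT, nT, sT, hmT, hT⟩ := hT.cases
  obtain ⟨mM, nM, sM, hmM, hM⟩ := hM.cases
  obtain ⟨mB, nB, sB, hmB, hB⟩ := hB.cases
  have n2 : D.overpass x ≠ D.overpass z := by simp [overpass, hxz]
  have n3 : D.overpass y ≠ D.overpass z := by simp [overpass, hyz]
  have n4 : D.underpass x ≠ D.underpass y := by simp [underpass, hxy]
  have n5 : D.underpass x ≠ D.underpass z := by simp [underpass, hxz]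
  have n6 : D.underpass y ≠ D.underpass z := by simp [underpass, hyz]
  have n7 : ∀ a b, D.overpass a ≠ D.underpass b := overpass_ne_underpass
  have hx : x ∈ ({x, y, z} : Set D.C) := by simp
  have hy : y ∈ ({x, y, z} : Set D.C) := by simp
  have hz : z ∈ ({x, y, z} : Set D.C) := by simp
  have hmMS : ∃ c ∈ ({x, y, z} : Set D.C), mM.1 = Sum.inl c := by
    rcases hM with ⟨rfl, -, -⟩ | ⟨rfl, -, -⟩
    exacts [⟨x, hx, rfl⟩, ⟨z, hz, rfl⟩]
  have hnMS : ∃ c ∈ ({x, y, z} : Set D.C), (D.next mM).1 = Sum.inl c := by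
    rw [hmM]
    rcases hM with ⟨-, rfl, -⟩ | ⟨-, rfl, -⟩
    exacts [⟨z, hz, rfl⟩, ⟨x, hx, rfl⟩]
  have hmBS : ∃ c ∈ ({x, y, z} : Set D.C), mB.1 = Sum.inl c := by
    rcases hB with ⟨rfl, -, -⟩ | ⟨rfl, -, -⟩
    exacts [⟨y, hy, rfl⟩, ⟨z, hz, rfl⟩]
  have hnBS : ∃ c ∈ ({x, y, z} : Set D.C), (D.next mB).1 = Sum.inl c := by
    rw [hmB]
    rcases hB with ⟨-, rfl, -⟩ | ⟨-, rfl, -⟩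
    exacts [⟨z, hz, rfl⟩, ⟨y, hy, rfl⟩]
  have hM0 : ∀ q, q ≠ D.underpass x → q ≠ D.overpass z → q ≠ mM ∧ q ≠ nM := by
    intro q h1 h2
    rcases hM with ⟨rfl, rfl, -⟩ | ⟨rfl, rfl, -⟩
    exacts [⟨h1, h2⟩, ⟨h2, h1⟩]
  have hB0 : ∀ q, q ≠ D.underpass y → q ≠ D.underpass z → q ≠ mB ∧ q ≠ nB := by
    intro q h1 h2
    rcases hB with ⟨rfl, rfl, -⟩ | ⟨rfl, rfl, -⟩
    exacts [⟨h1, h2⟩, ⟨h2, h1⟩]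
  have hMB : mM ≠ mB ∧ mM ≠ nB ∧ nM ≠ mB ∧ nM ≠ nB := by
    have h1 := hB0 (D.underpass x) n4 n5
    have h2 := hB0 (D.overpass z) (n7 _ _) (n7 _ _)
    rcases hM with ⟨rfl, rfl, -⟩ | ⟨rfl, rfl, -⟩
    exacts [⟨h1.1, h1.2, h2.1, h2.2⟩, ⟨h2.1, h2.2, h1.1, h1.2⟩]
  have hi : ∀ q m n, D.next m = n → q ≠ n → D.next.symm q ≠ m := by
    rintro q m _ rfl hq h
    exact hq (by rw [← h, Equiv.apply_symm_apply])
  have hiM : D.next.symm nM = mM := by rw [← hmM, Equiv.symm_apply_apply]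
  have hiB : D.next.symm nB = mB := by rw [← hmB, Equiv.symm_apply_apply]
  have hiT : D.next.symm nT = mT := by rw [← hmT, Equiv.symm_apply_apply]
  -- the change of the labels of the two edges of the triangle that lie below the upper strand
  let EB := replaceLabel mB (label mB + label (D.overpass x) + label (D.next.symm (D.overpass x)) -
    label (D.overpass z) - label (D.next.symm (D.overpass z)))
  let EM := replaceLabel mM
    (label (D.overpass x) + label (D.next.symm (D.overpass x)) - label mM)
  have hox := hM0 _ (n7 x x) n2
  have hox' := hB0 _ (n7 x y) (n7 x z)
  have hoz' := hB0 _ (n7 z y) (n7 z z)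
  have hEB : Function.Injective EB := by
    refine replaceLabel_injective _ _ fun v h0 h1 => ?_
    have : v mB + v (D.overpass x) + v (D.next.symm (D.overpass x)) -
      v (D.overpass z) - v (D.next.symm (D.overpass z)) = 0 := h0
    rw [h1 _ hox'.1, h1 _ hoz'.1, h1 _ (hi _ _ _ hmB hox'.2), h1 _ (hi _ _ _ hmB hoz'.2)] at this
    linarith
  have hEM : Function.Injective EM := by
    refine replaceLabel_injective _ _ fun v h0 h1 => ?_
    have : v (D.overpass x) + v (D.next.symm (D.overpass x)) - v mM = 0 := h0
    rw [h1 _ hox.1, h1 _ (hi _ _ _ hmM hox.2)] at this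
    linarith
  have w1 : ∀ v q, q ≠ mM → q ≠ mB → EM (EB v) q = v q := fun v q h1 h2 => by
    rw [replaceLabel_of_ne h1, replaceLabel_of_ne h2]
  have w2 : ∀ v q, q ≠ nM → q ≠ nB → EM (EB v) (D.next.symm q) = v (D.next.symm q) :=
    fun v q h1 h2 => w1 v _ (hi _ _ _ hmM h1) (hi _ _ _ hmB h2)
  have wM : ∀ v, EM (EB v) mM =
      v (D.overpass x) + v (D.next.symm (D.overpass x)) - v mM := by
    intro v
    rw [replaceLabel_same]
    simp only [LinearMap.add_apply, LinearMap.sub_apply, LinearMap.proj_apply]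
    rw [replaceLabel_of_ne hox'.1, replaceLabel_of_ne (hi _ _ _ hmB hox'.2),
      replaceLabel_of_ne hMB.1]
  have wB : ∀ v, EM (EB v) mB =
      v mB + v (D.overpass x) + v (D.next.symm (D.overpass x)) -
        v (D.overpass z) - v (D.next.symm (D.overpass z)) := by
    intro v
    rw [replaceLabel_of_ne hMB.1.symm, replaceLabel_same]
    rfl
  have sM0 : sM ≠ 0 := by rcases hM with ⟨-, -, rfl⟩ | ⟨-, -, rfl⟩ <;> norm_num
  -- the corresponding change of the equations
  let Fu := replaceLabel (D.underpass x) (-sM • label (D.underpass x))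
  let Fo := replaceLabel (D.overpass z) (sM • label (D.overpass z) -
    sT • (label (D.overpass x) + label (D.overpass y)))
  let Fb := replaceLabel (D.underpass y) (label (D.underpass y) - label (D.underpass x) +
    sT • (label (D.overpass x) + label (D.overpass y)) - sM • label (D.overpass z))
  have hFu : Function.Injective Fu := by
    refine replaceLabel_injective _ _ fun v h0 h1 => ?_
    have : -sM * v (D.underpass x) = 0 := h0
    simpa [sM0] using this
  have hFo : Function.Injective Fo := by
    refine replaceLabel_injective _ _ fun v h0 h1 => ?_
    have : sM * v (D.overpass z) - sT * (v (D.overpass x) + v (D.overpass y)) = 0 := h0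
    rw [h1 _ n2, h1 _ n3] at this
    simpa [sM0] using this
  have hFb : Function.Injective Fb := by
    refine replaceLabel_injective _ _ fun v h0 h1 => ?_
    have : v (D.underpass y) - v (D.underpass x) +
      sT * (v (D.overpass x) + v (D.overpass y)) - sM * v (D.overpass z) = 0 := h0
    rw [h1 _ (n7 _ _), h1 _ (n7 _ _), h1 _ (n7 _ _), h1 _ n4] at this
    simpa using this
  refine det_eq_const_mul_of_intertwine (A := B) (B := D.coloringMap) (EM ∘ₗ EB)
    (Fu ∘ₗ Fo ∘ₗ Fb) (hEM.comp hEB) (hFu.comp (hFo.comp hFb)) (fun u v => ?_)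
  · -- relations between the labels of the edges of the triangle and their neighbours
    have eT : v (D.overpass x) + v (D.next.symm (D.overpass x)) - v (D.overpass y) -
        v (D.next.symm (D.overpass y)) = -sT * (v (D.overpass x) - v (D.next.symm (D.overpass x)) +
        (v (D.overpass y) - v (D.next.symm (D.overpass y)))) := by
      rcases hT with ⟨rfl, rfl, rfl⟩ | ⟨rfl, rfl, rfl⟩ <;> rw [hiT] <;> ring
    have eM1 : EM (EB v) (D.underpass x) - EM (EB v) (D.next.symm (D.underpass x)) =
        -sM * (v (D.underpass x) + v (D.next.symm (D.underpass x)) - v (D.overpass x) -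
          v (D.next.symm (D.overpass x))) := by
      rcases hM with ⟨rfl, rfl, rfl⟩ | ⟨rfl, rfl, rfl⟩
      · rw [wM, w2 _ _ (n7 _ _).symm hMB.2.1]; ring
      · rw [hiM, wM, w1 _ _ (n7 _ _).symm hMB.2.2.1]; ring
    have eM2 : EM (EB v) (D.underpass x) + EM (EB v) (D.next.symm (D.underpass x)) =
        v (D.overpass x) + v (D.next.symm (D.overpass x)) +
          sM * (v (D.next.symm (D.underpass x)) - v (D.underpass x)) := by
      rcases hM with ⟨rfl, rfl, rfl⟩ | ⟨rfl, rfl, rfl⟩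
      · rw [wM, w2 _ _ (n7 _ _).symm hMB.2.1]; ring
      · rw [hiM, wM, w1 _ _ (n7 _ _).symm hMB.2.2.1]; ring
    have eM3 : EM (EB v) (D.overpass z) + EM (EB v) (D.next.symm (D.overpass z)) =
        v (D.overpass x) + v (D.next.symm (D.overpass x)) +
          sM * (v (D.overpass z) - v (D.next.symm (D.overpass z))) := by
      rcases hM with ⟨rfl, rfl, rfl⟩ | ⟨rfl, rfl, rfl⟩
      · rw [hiM, wM, w1 _ _ (n7 _ _) hMB.2.2.1]; ring
      · rw [wM, w2 _ _ (n7 _ _) hMB.2.1]; ring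
    have eM4 : sM * (v (D.next.symm (D.underpass x)) - v (D.underpass x)) +
        v (D.overpass z) + v (D.next.symm (D.overpass z)) =
        v (D.underpass x) + v (D.next.symm (D.underpass x)) +
          sM * (v (D.overpass z) - v (D.next.symm (D.overpass z))) := by
      rcases hM with ⟨rfl, rfl, rfl⟩ | ⟨rfl, rfl, rfl⟩ <;> rw [hiM] <;> ring
    have eB1 : EM (EB v) (D.underpass y) + EM (EB v) (D.next.symm (D.underpass y)) =
        v (D.underpass y) + v (D.next.symm (D.underpass y)) + v (D.overpass x) +
          v (D.next.symm (D.overpass x)) - v (D.overpass z) - v (D.next.symm (D.overpass z)) := by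
      have h1 := hM0 _ n4.symm (n7 z y).symm
      rcases hB with ⟨rfl, rfl, rfl⟩ | ⟨rfl, rfl, rfl⟩
      · rw [wB, w2 _ _ h1.2 n6]; ring
      · rw [hiB, wB, w1 _ _ h1.1 n6]; ring
    have eB2 : EM (EB v) (D.underpass z) + EM (EB v) (D.next.symm (D.underpass z)) =
        v (D.underpass z) + v (D.next.symm (D.underpass z)) + v (D.overpass x) +
          v (D.next.symm (D.overpass x)) - v (D.overpass z) - v (D.next.symm (D.overpass z)) := by
      have h1 := hM0 _ n5.symm (n7 z z).symm
      rcases hB with ⟨rfl, rfl, rfl⟩ | ⟨rfl, rfl, rfl⟩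
      · rw [hiB, wB, w1 _ _ h1.1 n6.symm]; ring
      · rw [wB, w2 _ _ h1.2 n6.symm]; ring
    have hoy := hM0 _ (n7 y x) n3
    have hoy' := hB0 _ (n7 y y) (n7 y z)
    have wx := w1 v _ hox.1 hox'.1
    have wx' := w2 v _ hox.2 hox'.2
    have wy := w1 v _ hoy.1 hoy'.1
    have wy' := w2 v _ hoy.2 hoy'.2
    ext p
    simp only [LinearMap.comp_apply]
    have hcases : p = D.overpass x ∨ p = D.overpass y ∨ p = D.overpass z ∨ p = D.underpass x ∨
        p = D.underpass y ∨ p = D.underpass z ∨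
        ¬ ∃ e ∈ ({x, y, z} : Set D.C), p.1 = Sum.inl e := by
      rcases passage_cases {x, y, z} p with ⟨e, he, rfl⟩ | ⟨e, he, rfl⟩ | hp
      · rcases he with rfl | rfl | rfl <;> simp
      · rcases he with rfl | rfl | rfl <;> simp
      · exact .inr (.inr (.inr (.inr (.inr (.inr hp)))))
    rcases hcases with rfl | rfl | rfl | rfl | rfl | rfl | hp
    · rw [b1, replaceLabel_of_ne (n7 _ _), replaceLabel_of_ne n2, replaceLabel_of_ne (n7 _ _),
        coloringMap_over, wx, wx']
    · rw [b2, replaceLabel_of_ne (n7 _ _), replaceLabel_of_ne n3, replaceLabel_of_ne (n7 _ _),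
        coloringMap_over, wy, wy']
    · rw [b4, replaceLabel_of_ne (n7 _ _), replaceLabel_same]
      simp only [LinearMap.add_apply, LinearMap.sub_apply, LinearMap.smul_apply,
        LinearMap.proj_apply, smul_eq_mul]
      rw [replaceLabel_of_ne (n7 _ _), replaceLabel_of_ne (n7 _ _), replaceLabel_of_ne (n7 _ _),
        coloringMap_over, coloringMap_over, coloringMap_over, wy, wy']
      linear_combination eM3 + eT
    · rw [b3, replaceLabel_same]
      simp only [LinearMap.smul_apply, LinearMap.proj_apply, smul_eq_mul]
      rw [replaceLabel_of_ne (n7 _ _).symm, replaceLabel_of_ne n4, coloringMap_under, eM1]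
    · rw [b5, replaceLabel_of_ne n4.symm, replaceLabel_of_ne (n7 _ _).symm, replaceLabel_same]
      simp only [LinearMap.add_apply, LinearMap.sub_apply, LinearMap.smul_apply,
        LinearMap.proj_apply, smul_eq_mul]
      rw [coloringMap_over, coloringMap_over, coloringMap_over, coloringMap_under,
        coloringMap_under]
      linear_combination eB1 - eM2 - eM4 - eT
    · rw [b6, replaceLabel_of_ne n5.symm, replaceLabel_of_ne (n7 _ _).symm,
        replaceLabel_of_ne n6.symm, coloringMap_under, wx, wx']
      linear_combination eB2
    · have e1 : ∀ c ∈ ({x, y, z} : Set D.C), ∀ b, p ≠ (Sum.inl c, b) := by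
        rintro c hc b rfl
        exact hp ⟨c, hc, rfl⟩
      rw [b7 _ _ _ hp, coloringMap_replaceLabel hmMS hnMS hp, coloringMap_replaceLabel hmBS hnBS hp,
        replaceLabel_of_ne (show p ≠ D.underpass x from e1 x hx _),
        replaceLabel_of_ne (show p ≠ D.overpass z from e1 z hz _),
        replaceLabel_of_ne (show p ≠ D.underpass y from e1 y hy _)]

theorem Reidemeister3.proportionalDet (h : D.Reidemeister3 D') : ProportionalDet D' D := by
  obtain ⟨x, y, z, oT, oM, oB, τs, eC, eV, hxy, hxz, hyz, hT, hM, hB, -, -, -, -, hloops, hnext⟩ := h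
  set σ : Equiv.Perm D.Passage :=
    Equiv.swap (D.overpass x) (D.overpass y) * Equiv.swap (D.underpass x) (D.overpass z) *
      Equiv.swap (D.underpass y) (D.underpass z) with hσ
  obtain ⟨σ1, σ2, σ3, σ4, σ5, σ6, σ7⟩ := swap_mul_swap_mul_swap_apply (a := D.overpass x)
    (b := D.overpass y) (c := D.underpass x) (d := D.overpass z) (e := D.underpass y)
    (f := D.underpass z) (by simp [overpass, underpass, hxy, hxz, hyz])
  rw [← hσ] at σ1 σ2 σ3 σ4 σ5 σ6 σ7
  -- `τ` matches the passages of the two diagrams so that it respects the order along the strands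
  let τ : D.Passage ≃ D'.Passage :=
    σ.trans ((Equiv.sumCongr eC eV).prodCongr (Equiv.refl Bool))
  have hτ : ∀ p, τ p = (Sum.map eC eV (σ p).1, (σ p).2) := fun p => rfl
  have τ1 : τ (D.overpass x) = D'.overpass (eC y) := by rw [hτ, σ1]; rfl
  have τ2 : τ (D.overpass y) = D'.overpass (eC x) := by rw [hτ, σ2]; rfl
  have τ3 : τ (D.underpass x) = D'.overpass (eC z) := by rw [hτ, σ3]; rfl
  have τ4 : τ (D.overpass z) = D'.underpass (eC x) := by rw [hτ, σ4]; rfl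
  have τ5 : τ (D.underpass y) = D'.underpass (eC z) := by rw [hτ, σ5]; rfl
  have τ6 : τ (D.underpass z) = D'.underpass (eC y) := by rw [hτ, σ6]; rfl
  have hτnext : ∀ p, D'.next.symm (τ p) = τ (D.next.symm p) := by
    intro p
    rw [Equiv.symm_apply_eq, hτ (D.next.symm p), hnext, Equiv.apply_symm_apply, ← hτ]
  let T : (D.Passage → ℝ) ≃ₗ[ℝ] (D'.Passage → ℝ) := LinearEquiv.funCongrLeft ℝ ℝ τ.symm
  let B : ℝ → (D.Passage → ℝ) →ₗ[ℝ] (D.Passage → ℝ) := fun u =>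
    (T.symm : (D'.Passage → ℝ) →ₗ[ℝ] (D.Passage → ℝ)) ∘ₗ D'.coloringMap u ∘ₗ
      (T : (D.Passage → ℝ) →ₗ[ℝ] (D'.Passage → ℝ))
  have hdet : ∀ u, LinearMap.det (B u) = LinearMap.det (D'.coloringMap u) :=
    fun u => LinearMap.det_conj (D'.coloringMap u) T.symm
  have hB' : ∀ u w p, B u w p = D'.coloringMap u (w ∘ τ.symm) (τ p) := fun u w p => rfl
  have hw1 : ∀ (w : D.Passage → ℝ) p q, τ p = q → (w ∘ τ.symm) q = w p := by
    rintro w p _ rfl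
    simp
  have hw2 : ∀ (w : D.Passage → ℝ) p q, τ p = q →
      (w ∘ τ.symm) (D'.next.symm q) = w (D.next.symm p) := by
    rintro w p _ rfl
    simp [hτnext]
  -- the equations of `D'` in terms of the passages of `D`
  have b1 : ∀ u w, B u w (D.overpass x) =
      w (D.overpass x) - w (D.next.symm (D.overpass x)) := by
    intro u w
    rw [hB', τ1, coloringMap_over, hw1 w _ _ τ1, hw2 w _ _ τ1]
  have b2 : ∀ u w, B u w (D.overpass y) =
      w (D.overpass y) - w (D.next.symm (D.overpass y)) := by
    intro u w
    rw [hB', τ2, coloringMap_over, hw1 w _ _ τ2, hw2 w _ _ τ2]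
  have b3 : ∀ u w, B u w (D.underpass x) =
      w (D.underpass x) - w (D.next.symm (D.underpass x)) := by
    intro u w
    rw [hB', τ3, coloringMap_over, hw1 w _ _ τ3, hw2 w _ _ τ3]
  have b4 : ∀ u w, B u w (D.overpass z) =
      w (D.overpass z) + w (D.next.symm (D.overpass z)) - w (D.overpass y) -
        w (D.next.symm (D.overpass y)) := by
    intro u w
    rw [hB', τ4, coloringMap_under, hw1 w _ _ τ4, hw2 w _ _ τ4, hw1 w _ _ τ2, hw2 w _ _ τ2]
  have b5 : ∀ u w, B u w (D.underpass y) =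
      w (D.underpass y) + w (D.next.symm (D.underpass y)) - w (D.underpass x) -
        w (D.next.symm (D.underpass x)) := by
    intro u w
    rw [hB', τ5, coloringMap_under, hw1 w _ _ τ5, hw2 w _ _ τ5, hw1 w _ _ τ3, hw2 w _ _ τ3]
  have b6 : ∀ u w, B u w (D.underpass z) =
      w (D.underpass z) + w (D.next.symm (D.underpass z)) - w (D.overpass x) -
        w (D.next.symm (D.overpass x)) := by
    intro u w
    rw [hB', τ6, coloringMap_under, hw1 w _ _ τ6, hw2 w _ _ τ6, hw1 w _ _ τ1, hw2 w _ _ τ1]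
  have b7 : ∀ u w p, (¬ ∃ c ∈ ({x, y, z} : Set D.C), p.1 = Sum.inl c) →
      B u w p = D.coloringMap u w p := by
    intro u w p hp
    have h7 : ∀ b, τ (p.1, b) = (Sum.map eC eV p.1, b) := by
      intro b
      rw [hτ, σ7]
      intro hb
      apply hp
      simp only [List.mem_cons, List.not_mem_nil, or_false, overpass, underpass,
        Prod.mk.injEq] at hb
      simp only [Set.mem_insert_iff, Set.mem_singleton_iff, exists_eq_or_imp, exists_eq_left]
      tauto
    rw [hB', show τ p = (Sum.map eC eV p.1, p.2) from h7 p.2]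
    have e1 := fun b => hw1 w _ _ (h7 b)
    have e2 := fun b => hw2 w _ _ (h7 b)
    clear_value B T τ
    obtain ⟨c | v, b⟩ := p
    · have a1 : (w ∘ τ.symm) (D'.overpass (eC c)) = w (D.overpass c) := e1 true
      have a2 : (w ∘ τ.symm) (D'.underpass (eC c)) = w (D.underpass c) := e1 false
      have a3 : (w ∘ τ.symm) (D'.next.symm (D'.overpass (eC c))) =
        w (D.next.symm (D.overpass c)) := e2 true
      have a4 : (w ∘ τ.symm) (D'.next.symm (D'.underpass (eC c))) =
        w (D.next.symm (D.underpass c)) := e2 false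
      cases b
      · change D'.coloringMap u _ (D'.underpass (eC c)) = D.coloringMap u w (D.underpass c)
        rw [coloringMap_under, coloringMap_under, a1, a2, a3, a4]
      · change D'.coloringMap u _ (D'.overpass (eC c)) = D.coloringMap u w (D.overpass c)
        rw [coloringMap_over, coloringMap_over, a1, a3]
    · have a1 : (w ∘ τ.symm) (Sum.inr (eV v), b) = w (Sum.inr v, b) := e1 b
      have a2 : (w ∘ τ.symm) (D'.next.symm (Sum.inr (eV v), b)) =
        w (D.next.symm (Sum.inr v, b)) := e2 b
      cases b
      · change D'.coloringMap u _ (Sum.inr (eV v), false) = D.coloringMap u w (Sum.inr v, false)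
        rw [coloringMap_virtual_false, coloringMap_virtual_false, a1, a2]
      · change D'.coloringMap u _ (Sum.inr (eV v), true) = D.coloringMap u w (Sum.inr v, true)
        rw [coloringMap_virtual_true, coloringMap_virtual_true, a1, a2]
  obtain ⟨c, hc, h⟩ := exists_det_eq_of_triangle hxy hxz hyz hT hM hB B b1 b2 b3 b4 b5 b6 b7
  refine ⟨c, hc, fun u _ => ?_⟩
  simp only [coloringDet, hloops]
  split_ifs
  · rw [← hdet, h]
  · simp

/-! ### Detour moves -/

/-- The colouring equations after the change of labels by an Alexander numbering. They are those of
an Alexander biquandle: they refer to the classical crossings and their signs only. -/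
noncomputable def biquandleRule {C : Type} (sign : C → ℤˣ) (u : ℝ) :
    ((C × Bool → ℝ) × (C × Bool → ℝ)) →ₗ[ℝ] (C × Bool → ℝ) where
  toFun z
    | (c, true) => z.1 (c, true) - u ^ (-(sign c : ℤ)) * z.2 (c, true)
    | (c, false) => z.1 (c, false) + u ^ (sign c : ℤ) * z.2 (c, false) -
        u ^ (sign c : ℤ) * z.1 (c, true) - z.2 (c, true)
  map_add' z w := by
    ext ⟨c, _ | _⟩ <;> simp only [Prod.fst_add, Prod.snd_add, Pi.add_apply] <;> ring
  map_smul' a z := by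
    ext ⟨c, _ | _⟩ <;>
      simp only [Prod.smul_fst, Prod.smul_snd, Pi.smul_apply, smul_eq_mul, RingHom.id_apply] <;>
      ring

/-- The equations of `biquandleRule` at the classical crossings of `D`; at the virtual crossings
labels do not change. -/
noncomputable def gaugedMap (D : DiagramData) (u : ℝ) :
    (D.Passage → ℝ) →ₗ[ℝ] (D.Passage → ℝ) where
  toFun x
    | (Sum.inl c, b) => biquandleRule D.sign u (x ∘ Prod.map Sum.inl id,
        x ∘ D.next.symm ∘ Prod.map Sum.inl id) (c, b)
    | (Sum.inr v, b) => x (Sum.inr v, b) - x (D.next.symm (Sum.inr v, b))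
  map_add' x y := by
    ext ⟨c | v, b⟩
    · exact congrFun (map_add (biquandleRule D.sign u) (x ∘ Prod.map Sum.inl id,
        x ∘ D.next.symm ∘ Prod.map Sum.inl id) (y ∘ Prod.map Sum.inl id,
        y ∘ D.next.symm ∘ Prod.map Sum.inl id)) (c, b)
    · simp only [Pi.add_apply]
      ring
  map_smul' a x := by
    ext ⟨c | v, b⟩
    · exact congrFun (map_smul (biquandleRule D.sign u) a (x ∘ Prod.map Sum.inl id,
        x ∘ D.next.symm ∘ Prod.map Sum.inl id)) (c, b)
    · simp only [Pi.smul_apply, smul_eq_mul, RingHom.id_apply]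
      ring

/-- The virtual weights of the colouring equations of a planar diagram can be gauged away: multiply
the label of each edge by a power of `u`, with minus its Alexander number as the exponent. -/
theorem det_coloringMap_eq_det_gaugedMap (hD : D.IsPlanar) {u : ℝ} (hu : u ≠ 0) :
    LinearMap.det (D.coloringMap u) = LinearMap.det (D.gaugedMap u) := by
  obtain ⟨I, hI⟩ := D.exists_alexander_numbering hD
  let S : (D.Passage → ℝ) →ₗ[ℝ] (D.Passage → ℝ) :=
    { toFun := fun x p => u ^ (-I p) * x p
      map_add' := fun x y => by ext p; simp only [Pi.add_apply]; ring
      map_smul' := fun a x => by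
        ext p; simp only [Pi.smul_apply, smul_eq_mul, RingHom.id_apply]; ring }
  have hS : ∀ x p, S x p = u ^ (-I p) * x p := fun x p => rfl
  have hSinj : Function.Injective S := by
    rw [← LinearMap.ker_eq_bot, LinearMap.ker_eq_bot']
    intro x hx
    ext p
    have h1 := congrFun hx p
    rw [hS] at h1
    exact (mul_eq_zero.1 h1).resolve_left (zpow_ne_zero _ hu)
  have hSdet : LinearMap.det S ≠ 0 :=
    (LinearEquiv.isUnit_det' (LinearEquiv.ofInjectiveEndo S hSinj)).ne_zero
  have hcl : ∀ c, I (D.next.symm (D.overpass c)) = I (D.overpass c) + D.sign c ∧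
      I (D.next.symm (D.underpass c)) = I (D.underpass c) - D.sign c ∧
      I (D.overpass c) = I (D.underpass c) - D.sign c ∧
      I (D.next.symm (D.overpass c)) = I (D.underpass c) := by
    intro c
    rcases Int.units_eq_one_or (D.sign c) with hs | hs
    · have h := hI (D.underpass c) (by simp [underpass, otherGoesLeftToRight, hs])
      rw [show D.other (D.underpass c) = D.overpass c from rfl] at h
      rw [hs]
      push_cast
      omega
    · have h := hI (D.overpass c) (by simp [overpass, otherGoesLeftToRight, hs])
      rw [show D.other (D.overpass c) = D.underpass c from rfl] at h
      rw [hs]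
      push_cast
      omega
  have hcomm : D.coloringMap u ∘ₗ S = S ∘ₗ D.gaugedMap u := by
    refine LinearMap.ext fun x => funext fun p => ?_
    rw [LinearMap.comp_apply, LinearMap.comp_apply, hS]
    obtain ⟨c | v, b⟩ := p
    · obtain ⟨h1, h2, h3, h4⟩ := hcl c
      cases b
      · change D.coloringMap u (S x) (D.underpass c) = u ^ (-I (D.underpass c)) *
          (x (D.underpass c) + u ^ (D.sign c : ℤ) * x (D.next.symm (D.underpass c)) -
            u ^ (D.sign c : ℤ) * x (D.overpass c) - x (D.next.symm (D.overpass c)))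
        rw [coloringMap_under, hS, hS, hS, hS, h2, h3, h4,
          show -(I (D.underpass c) - (D.sign c : ℤ)) = -I (D.underpass c) + D.sign c by ring,
          zpow_add₀ hu]
        ring
      · change D.coloringMap u (S x) (D.overpass c) = u ^ (-I (D.overpass c)) *
          (x (D.overpass c) - u ^ (-(D.sign c : ℤ)) * x (D.next.symm (D.overpass c)))
        rw [coloringMap_over, hS, hS, h1, neg_add, zpow_add₀ hu]
        ring
    · have h := hI (Sum.inr v, true) rfl
      rw [show D.other (Sum.inr v, true) = (Sum.inr v, false) from rfl] at h
      cases b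
      · change D.coloringMap u (S x) (Sum.inr v, false) = u ^ (-I (Sum.inr v, false)) *
          (x (Sum.inr v, false) - x (D.next.symm (Sum.inr v, false)))
        have e : -I (Sum.inr v, false) = -I (D.next.symm (Sum.inr v, false)) + 1 := by omega
        rw [coloringMap_virtual_false, hS, hS, e, zpow_add₀ hu, zpow_one]
        ring
      · change D.coloringMap u (S x) (Sum.inr v, true) = u ^ (-I (Sum.inr v, true)) *
          (x (Sum.inr v, true) - x (D.next.symm (Sum.inr v, true)))
        have e : -I (Sum.inr v, true) = -I (D.next.symm (Sum.inr v, true)) + (-1) := by omega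
        rw [coloringMap_virtual_true, hS, hS, e, zpow_add₀ hu, zpow_neg_one]
        ring
  have h := congrArg LinearMap.det hcomm
  rw [LinearMap.det_comp, LinearMap.det_comp, mul_comm] at h
  exact mul_left_cancel₀ hSdet h

/-- The colouring determinant of a planar diagram is determined, up to a constant, by the classical
crossings, their signs, the order in which they are passed and the number of components. -/
theorem coloringDet_of_firstReturn (hD : D.IsPlanar) {C : Type} [Finite C] (e : C ≃ D.C)
    {ρ : Equiv.Perm (C × Bool)}
    (h : IsFirstReturn D.next (fun p : C × Bool => ((Sum.inl (e p.1), p.2) : D.Passage)) ρ) :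
    (D.numComponents = numOrbits ρ ∧ ∃ c : ℝ, c ≠ 0 ∧ ∀ u : ℝ, u ≠ 0 → D.coloringDet u =
      c * LinearMap.det (edgeMap ρ (biquandleRule (fun c => D.sign (e c)) u))) ∨
    (D.numComponents ≠ numOrbits ρ ∧ ∀ u : ℝ, u ≠ 0 → D.coloringDet u = 0) := by
  set j : C × Bool → D.Passage := fun p => (Sum.inl (e p.1), p.2) with hj
  have hjinj : Function.Injective j := by
    rintro ⟨x, b⟩ ⟨y, b'⟩ hxy
    simpa [hj] using hxy
  have hn : ∀ u x p, p ∉ Set.range j → D.gaugedMap u x p = x p - x (D.next.symm p) := by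
    rintro u x ⟨c | v, b⟩ hp
    · exact absurd ⟨(e.symm c, b), by simp [hj]⟩ hp
    · rfl
  have hr : ∀ u x b, D.gaugedMap u x (j b) =
      biquandleRule (fun c => D.sign (e c)) u (x ∘ j, x ∘ D.next.symm ∘ j) b := by
    rintro u x ⟨c, _ | _⟩ <;> rfl
  simp only [numComponents]
  rcases h.numOrbits hjinj with ⟨hs, he⟩ | ⟨hs, hlt⟩
  · by_cases hl : D.loops = 0
    · refine .inl ⟨by omega, ?_⟩
      obtain ⟨c, hc, h'⟩ := h.exists_det_eq hjinj hs
      refine ⟨c, hc, fun u hu => ?_⟩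
      rw [coloringDet, if_pos hl, det_coloringMap_eq_det_gaugedMap hD hu]
      exact h' _ _ _ (hr u) (hn u) fun x => rfl
    · exact .inr ⟨by omega, fun u _ => if_neg hl⟩
  · refine .inr ⟨by omega, fun u hu => ?_⟩
    rw [coloringDet, det_coloringMap_eq_det_gaugedMap hD hu,
      det_eq_zero_of_missed_cycle hs _ _ (hr u) (hn u), ite_self]

theorem Detour.proportionalDet (hD : D.IsPlanar) (hD' : D'.IsPlanar) (h : D.Detour D') :
    ProportionalDet D D' := by
  obtain ⟨e, ρ, hsign, h, h', hcomp⟩ := h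
  have hinj : Function.Injective ρ := by
    refine h.injective ?_
    rintro ⟨x, b⟩ ⟨y, b'⟩ hxy
    simpa using hxy
  let ρ' : Equiv.Perm (D.C × Bool) := Equiv.ofBijective ρ (Finite.injective_iff_bijective.1 hinj)
  have h1 := coloringDet_of_firstReturn hD (Equiv.refl D.C) (ρ := ρ') h
  have h2 := coloringDet_of_firstReturn hD' e (ρ := ρ') h'
  have hs : (fun c => D'.sign (e c)) = fun c => D.sign (Equiv.refl D.C c) := funext hsign
  rw [hs, hcomp] at h2
  rcases h1 with ⟨h1, c, hc, hdet⟩ | ⟨h1, hdet⟩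
  · rcases h2 with ⟨-, c', hc', hdet'⟩ | ⟨h2, -⟩
    · refine ⟨c / c', div_ne_zero hc hc', fun u hu => ?_⟩
      rw [hdet u hu, hdet' u hu]
      field_simp
    · exact absurd h1 h2
  · rcases h2 with ⟨h2, -⟩ | ⟨-, hdet'⟩
    · exact absurd h2 h1
    · exact ⟨1, one_ne_zero, fun u hu => by rw [hdet u hu, hdet' u hu, one_mul]⟩

end DiagramData

open DiagramData in
/-- The colouring determinant, up to a constant factor, is an invariant of virtual links. -/
theorem VirtualDiagram.proportionalDet_of_link_eq {D D' : VirtualDiagram} (h : D.link = D'.link) :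
    ProportionalDet D.toDiagramData D'.toDiagramData := by
  have h' : Relation.EqvGen VirtualDiagram.Move D D' := Quotient.exact h
  clear h
  induction h' with
  | rel D D' h =>
    rcases h with h | h | h | h
    · exact h.proportionalDet
    · exact h.proportionalDet
    · exact h.proportionalDet.symm
    · exact h.proportionalDet D.planar D'.planar
  | refl D => exact ⟨1, one_ne_zero, fun u _ => (one_mul _).symm⟩
  | symm D D' _ ih => exact ih.symm
  | trans D D' D'' _ _ ih1 ih2 => exact ih1.trans ih2

namespace DiagramData

variable {D : DiagramData}

/-! ### The coefficient of highest degree -/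

/-- The colouring equations, those at the increasing virtual passages being multiplied by `u`, so that
the coefficients are polynomials in `u`. -/
noncomputable def scaledMap (D : DiagramData) (u : ℝ) :
    (D.Passage → ℝ) →ₗ[ℝ] (D.Passage → ℝ) where
  toFun x
    | (Sum.inl c, b) => D.coloringMap 1 x (Sum.inl c, b)
    | (Sum.inr v, true) => u * x (Sum.inr v, true) - x (D.next.symm (Sum.inr v, true))
    | (Sum.inr v, false) => x (Sum.inr v, false) - u * x (D.next.symm (Sum.inr v, false))
  map_add' x y := by
    ext ⟨c | v, _ | _⟩ <;> simp only [map_add, Pi.add_apply] <;> ring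
  map_smul' a x := by
    ext ⟨c | v, _ | _⟩ <;>
      simp only [map_smul, Pi.smul_apply, smul_eq_mul, RingHom.id_apply] <;> ring

theorem det_scaledMap {u : ℝ} (hu : u ≠ 0) :
    LinearMap.det (D.scaledMap u) =
      u ^ Fintype.card D.V * LinearMap.det (D.coloringMap u) := by
  let d : D.Passage → ℝ := fun p =>
    match p with
    | (Sum.inr _, true) => u
    | _ => 1
  have h : D.scaledMap u = Matrix.toLin' (Matrix.diagonal d) ∘ₗ D.coloringMap u := by
    refine LinearMap.ext fun x => funext fun p => ?_
    rw [LinearMap.comp_apply, Matrix.toLin'_apply, Matrix.mulVec_diagonal]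
    obtain ⟨c | v, _ | _⟩ := p
    · exact (one_mul _).symm
    · exact (one_mul _).symm
    · exact (one_mul _).symm
    · change u * _ - _ = u * (_ - u⁻¹ * _)
      rw [mul_sub, mul_inv_cancel_left₀ hu]
      rfl
  rw [h, LinearMap.det_comp, LinearMap.det_toLin', Matrix.det_diagonal, Fintype.prod_prod_type,
    Fintype.prod_sum_type]
  simp [d]

theorem continuous_det_scaledMap : Continuous fun u => LinearMap.det (D.scaledMap u) := by
  simp only [← LinearMap.det_toMatrix']
  refine Continuous.matrix_det (continuous_matrix fun p q => ?_)
  simp only [LinearMap.toMatrix'_apply]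
  obtain ⟨c | v, _ | _⟩ := p
  · exact continuous_const
  · exact continuous_const
  · exact continuous_const.sub (continuous_id.mul continuous_const)
  · exact (continuous_id.mul continuous_const).sub continuous_const

/-- If the colouring determinant of `D`, as a function of `u⁻¹`, has the greatest possible degree,
then `D` does not have more virtual crossings than a diagram with proportional determinant. -/
theorem ProportionalDet.card_le {D' : DiagramData} (h : ProportionalDet D D')
    (hl : D.loops = 0) (hdet : LinearMap.det (D.scaledMap 0) ≠ 0) :
    Fintype.card D.V ≤ Fintype.card D'.V := by
  by_contra! hlt
  obtain ⟨k, hk⟩ := Nat.exists_eq_add_of_lt hlt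
  obtain ⟨c, hc, h⟩ := h
  apply hdet
  set g : ℝ → ℝ := fun u =>
    if D'.loops = 0 then c * u ^ (k + 1) * LinearMap.det (D'.scaledMap u) else 0 with hg
  have hgc : Continuous g := by
    by_cases hl' : D'.loops = 0
    · simp only [hg, if_pos hl']
      exact (continuous_const.mul (continuous_id.pow _)).mul continuous_det_scaledMap
    · simp only [hg, if_neg hl']
      exact continuous_const
  have heq : ∀ u : ℝ, u ≠ 0 → LinearMap.det (D.scaledMap u) = g u := by
    intro u hu
    have h1 := h u hu
    rw [coloringDet, if_pos hl] at h1
    rw [det_scaledMap hu, h1, coloringDet, hk]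
    by_cases hl' : D'.loops = 0
    · simp only [hg, if_pos hl', det_scaledMap hu]
      ring
    · simp only [hg, if_neg hl', mul_zero]
  have h0 : LinearMap.det (D.scaledMap 0) = g 0 :=
    congrFun (Continuous.ext_on (dense_compl_singleton (0 : ℝ)) continuous_det_scaledMap hgc
      fun u hu => heq u hu) 0
  rw [h0]
  simp [hg]

/-! ### Long arcs -/

theorem point_zero (j : D.C) : D.point j 0 = D.underpass j := rfl

theorem point_succ (j : D.C) (m : ℕ) : D.point j (m + 1) = D.next (D.point j m) := by
  rw [point, pow_succ', Equiv.Perm.mul_apply]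
  rfl

theorem next_symm_point_succ (j : D.C) (m : ℕ) :
    D.next.symm (D.point j (m + 1)) = D.point j m := by
  rw [point_succ, Equiv.symm_apply_apply]

theorem isUnder_underpass (c : D.C) : D.isUnder (D.underpass c) = true := rfl

theorem eq_underpass_of_isUnder {p : D.Passage} (h : D.isUnder p = true) :
    ∃ c, p = D.underpass c := by
  obtain ⟨c | v, _ | _⟩ := p
  · exact ⟨c, rfl⟩
  all_goals simp [isUnder] at h

theorem point_add_of_point_eq {j j' : D.C} {m : ℕ} (h : D.point j m = D.underpass j') (n : ℕ) :
    D.point j (m + n) = D.point j' n := by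
  rw [point, add_comm, pow_add, Equiv.Perm.mul_apply, ← point, h]
  rfl

theorem IsProper.arcLength_mem (h : D.IsProper) (j : D.C) :
    0 < D.arcLength j ∧ D.isUnder (D.point j (D.arcLength j)) = true := by
  obtain ⟨m, hm⟩ := h.2 (D.next (D.underpass j))
  refine Nat.sInf_mem (s := {m : ℕ | 0 < m ∧ D.isUnder (D.point j m) = true})
    ⟨m + 1, m.succ_pos, ?_⟩
  rwa [point, pow_succ, Equiv.Perm.mul_apply]

theorem not_isUnder_point {j : D.C} {m : ℕ} (h0 : 0 < m) (h : m < D.arcLength j) :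
    D.isUnder (D.point j m) = false := by
  by_contra hm
  exact Nat.notMem_of_lt_sInf h ⟨h0, by simpa using hm⟩

/-- On a proper diagram, every edge lies on a long arc. -/
theorem IsProper.exists_point_eq (h : D.IsProper) (p : D.Passage) :
    ∃ j, ∃ m < D.arcLength j, D.point j m = p := by
  classical
  have hex : ∃ n, ∃ j, D.point j n = p := by
    obtain ⟨m, hm⟩ := h.2 p
    obtain ⟨j, hj⟩ := eq_underpass_of_isUnder hm
    have : D.next.SameCycle (D.underpass j) p := by
      rw [← hj]
      exact (Equiv.Perm.sameCycle_pow_left).2 (Equiv.Perm.SameCycle.refl _ _)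
    obtain ⟨n, hn⟩ := this.exists_nat_pow_eq
    exact ⟨n, j, hn⟩
  obtain ⟨j, hj⟩ := Nat.find_spec hex
  refine ⟨j, _, ?_, hj⟩
  by_contra! hle
  obtain ⟨hpos, hu⟩ := h.arcLength_mem j
  obtain ⟨j', hj'⟩ := eq_underpass_of_isUnder hu
  obtain ⟨d, hd⟩ := Nat.exists_eq_add_of_le hle
  rw [hd, point_add_of_point_eq hj'] at hj
  exact Nat.find_min hex (by omega) ⟨j', hj⟩

theorem point_injective {j j' : D.C} {m m' : ℕ} (hm : m < D.arcLength j)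
    (hm' : m' < D.arcLength j') (h : D.point j m = D.point j' m') : j = j' ∧ m = m' := by
  have key : ∀ j j' : D.C, ∀ m d : ℕ, m + d < D.arcLength j' →
      D.point j m = D.point j' (m + d) → j = j' ∧ m = m + d := by
    intro j j' m d hd h
    have h1 : D.underpass j = D.point j' d := by
      apply (D.next ^ m).injective
      change D.point j m = _
      rw [h, point, pow_add, Equiv.Perm.mul_apply]
      rfl
    rcases Nat.eq_zero_or_pos d with rfl | hpos
    · rw [point_zero] at h1
      refine ⟨?_, rfl⟩
      simpa [underpass] using h1
    · have h2 := not_isUnder_point hpos (show d < D.arcLength j' by omega)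
      rw [← h1, isUnder_underpass] at h2
      exact absurd h2 (by simp)
  rcases le_total m m' with hle | hle
  · obtain ⟨d, rfl⟩ := Nat.exists_eq_add_of_le hle
    exact key j j' m d hm' h
  · obtain ⟨d, rfl⟩ := Nat.exists_eq_add_of_le hle
    have := key j' j m' d hm h.symm
    exact ⟨this.1.symm, this.2.symm⟩

theorem arcNumber_succ (j : D.C) (m : ℕ) :
    D.arcNumber j (m + 1) =
      D.arcNumber j m + if D.isVirtual (D.point j (m + 1)) = true then 1 else 0 := by
  simp only [arcNumber, Finset.card_filter]
  exact Finset.sum_Icc_succ_top (by omega) _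

theorem arcNumber_mono (j : D.C) : Monotone (D.arcNumber j) :=
  monotone_nat_of_le_succ fun m => by rw [arcNumber_succ]; exact Nat.le_add_right _ _

/-! ### Critical arcs -/

/-- Up to a critical arc all virtual passages are increasing, and after it they are decreasing. -/
theorem step_ne_of_critical {j : D.C} {m : ℕ} (hm : m < D.arcLength j)
    (h : D.degree j m = D.numIncreasing j) :
    (∀ k, 1 ≤ k → k ≤ m → D.step (D.point j k) ≠ -1) ∧
      ∀ k, m < k → k < D.arcLength j → D.step (D.point j k) ≠ 1 := by
  let f : ℕ → ℤ := fun k => if D.step (D.point j k) = 1 then 1 else 0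
  have hf0 : ∀ k, 0 ≤ f k := fun k => by simp only [f]; split_ifs <;> norm_num
  have hf1 : ∀ p : D.Passage, D.step p ≤ if D.step p = 1 then 1 else 0 := by
    rintro ⟨c | v, _ | _⟩ <;> simp [step]
  have hsub : Finset.Icc 1 m ⊆ Finset.Ico 1 (D.arcLength j) := by
    intro k hk
    rw [Finset.mem_Icc] at hk
    rw [Finset.mem_Ico]
    omega
  have hnum : (D.numIncreasing j : ℤ) = ∑ k ∈ Finset.Ico 1 (D.arcLength j), f k := by
    rw [numIncreasing, Finset.card_filter]
    push_cast
    rfl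
  have h1 : D.degree j m ≤ ∑ k ∈ Finset.Icc 1 m, f k :=
    Finset.sum_le_sum fun k _ => hf1 _
  have h2 : ∑ k ∈ Finset.Icc 1 m, f k ≤ ∑ k ∈ Finset.Ico 1 (D.arcLength j), f k :=
    Finset.sum_le_sum_of_subset_of_nonneg hsub fun k _ _ => hf0 k
  constructor
  · intro k hk1 hkm hk
    have : D.degree j m < ∑ k ∈ Finset.Icc 1 m, f k := by
      refine Finset.sum_lt_sum (fun k _ => hf1 _) ⟨k, Finset.mem_Icc.2 ⟨hk1, hkm⟩, ?_⟩
      simp [f, hk]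
    omega
  · intro k hmk hkL hk
    have : ∑ k ∈ Finset.Icc 1 m, f k < ∑ k ∈ Finset.Ico 1 (D.arcLength j), f k := by
      refine Finset.sum_lt_sum_of_subset hsub (i := k) ?_ ?_ ?_ fun k _ _ => hf0 k
      · rw [Finset.mem_Ico]
        omega
      · rw [Finset.mem_Icc]
        omega
      · simp [f, hk]
    omega

theorem isVirtual_iff_step (p : D.Passage) :
    D.isVirtual p = true ↔ D.step p = 1 ∨ D.step p = -1 := by
  obtain ⟨c | v, _ | _⟩ := p <;> simp [isVirtual, step]

/-- A long arc has at most one critical arc. -/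
theorem arcNumber_eq_of_critical {j : D.C} {m m' : ℕ} (hm : m < D.arcLength j)
    (h : D.degree j m = D.numIncreasing j) (hm' : m' < D.arcLength j)
    (h' : D.degree j m' = D.numIncreasing j) : D.arcNumber j m = D.arcNumber j m' := by
  wlog hle : m ≤ m' generalizing m m'
  · exact (this hm' h' hm h (by omega)).symm
  have key : ∀ n, m ≤ n → n ≤ m' → D.arcNumber j m = D.arcNumber j n := by
    intro n hn
    induction n, hn using Nat.le_induction with
    | base => simp
    | succ n hn ih =>
      intro hnm
      have h1 := (step_ne_of_critical hm h).2 (n + 1) (by omega) (by omega)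
      have h2 := (step_ne_of_critical hm' h').1 (n + 1) (by omega) hnm
      rw [ih (by omega), arcNumber_succ, if_neg, add_zero]
      rw [isVirtual_iff_step]
      tauto
  exact key m' hle le_rfl

/-- For `u = 0`, a solution of the scaled equations vanishes on each long arc outside of the critical
arc, where it is constant. -/
theorem label_eq_of_scaledMap_zero {x : D.Passage → ℝ} (hx : D.scaledMap 0 x = 0) {j : D.C}
    {m₀ : ℕ} (hm₀ : m₀ < D.arcLength j) (h : D.degree j m₀ = D.numIncreasing j) {m : ℕ}
    (hm : m < D.arcLength j) :
    x (D.point j m) = if D.arcNumber j m = D.arcNumber j m₀ then x (D.point j m₀) else 0 := by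
  obtain ⟨hdec, hinc⟩ := step_ne_of_critical hm₀ h
  -- the effect of the passage number `n + 1` on the labels
  have hstep : ∀ n, n + 1 < D.arcLength j →
      (D.isVirtual (D.point j (n + 1)) = false ∧ x (D.point j (n + 1)) = x (D.point j n)) ∨
      (D.step (D.point j (n + 1)) = 1 ∧ x (D.point j n) = 0) ∨
      (D.step (D.point j (n + 1)) = -1 ∧ x (D.point j (n + 1)) = 0) := by
    intro n hn
    have hu := not_isUnder_point n.succ_pos hn
    have hi := next_symm_point_succ j n
    have hrow := congrFun hx (D.point j (n + 1))
    obtain ⟨p, hp⟩ : ∃ p, p = D.point j (n + 1) := ⟨_, rfl⟩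
    rw [Nat.succ_eq_add_one] at hu
    rw [← hp] at hu hi hrow ⊢
    rw [← hi]
    obtain ⟨c | v, _ | _⟩ := p
    · simp [isUnder] at hu
    · left
      have : x (D.overpass c) - x (D.next.symm (D.overpass c)) = 0 := hrow
      exact ⟨rfl, sub_eq_zero.1 this⟩
    · right; right
      have : x (Sum.inr v, false) - 0 * x (D.next.symm (Sum.inr v, false)) = 0 := hrow
      exact ⟨rfl, by simpa using this⟩
    · right; left
      have : 0 * x (Sum.inr v, true) - x (D.next.symm (Sum.inr v, true)) = 0 := hrow
      exact ⟨rfl, by simpa using this⟩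
  have hvirt : ∀ n, D.step (D.point j (n + 1)) = 1 ∨ D.step (D.point j (n + 1)) = -1 →
      D.arcNumber j (n + 1) = D.arcNumber j n + 1 := by
    intro n hn
    rw [arcNumber_succ, if_pos ((isVirtual_iff_step _).2 hn)]
  rcases le_total m₀ m with hle | hle
  · induction m, hle using Nat.le_induction with
    | base => simp
    | succ n hn ih =>
      rcases hstep n hm with ⟨h1, h2⟩ | ⟨h1, h2⟩ | ⟨h1, h2⟩
      · rw [h2, arcNumber_succ, h1]
        simpa using ih (by omega)
      · exact absurd h1 (hinc (n + 1) (by omega) hm)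
      · rw [h2, if_neg]
        have := hvirt n (.inr h1)
        have := arcNumber_mono j hn
        omega
  · obtain ⟨d, hd⟩ := Nat.exists_eq_add_of_le hle
    induction d generalizing m with
    | zero => simp [hd]
    | succ d ih =>
      have ih' := ih (m := m + 1) (by omega) (by omega) (by omega)
      rcases hstep m (by omega) with ⟨h1, h2⟩ | ⟨h1, h2⟩ | ⟨h1, h2⟩
      · rw [h2, arcNumber_succ, h1] at ih'
        simpa using ih'
      · rw [h2, if_neg]
        have := hvirt m (.inl h1)
        have := arcNumber_mono j (show m + 1 ≤ m₀ by omega)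
        omega
      · exact absurd h1 (hdec (m + 1) (by omega) (by omega))

/-! ### The reduced matrix of a special diagram -/

/-- A real matrix whose nonzero entries are those of a matrix of permanent one is regular, as there is
only one nonzero term in the expansion of its determinant. -/
theorem det_ne_zero_of_permanent_eq_one {n : Type} [Fintype n] [DecidableEq n]
    {M : Matrix n n ℕ} (hM : M.permanent = 1) {W : Matrix n n ℝ}
    (hW : ∀ i j, W i j ≠ 0 ↔ M i j ≠ 0) : W.det ≠ 0 := by
  rw [Matrix.permanent] at hM
  have hprod : ∀ σ : Equiv.Perm n, ∏ i, W (σ i) i ≠ 0 ↔ ∏ i, M (σ i) i ≠ 0 := by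
    intro σ
    simp only [Finset.prod_ne_zero_iff, hW]
  obtain ⟨σ, -, hσ⟩ := Finset.exists_ne_zero_of_sum_ne_zero
    (show ∑ σ : Equiv.Perm n, ∏ i, M (σ i) i ≠ 0 by omega)
  have hrest : ∀ τ, τ ≠ σ → ∏ i, M (τ i) i = 0 := by
    intro τ hτ
    rw [← Finset.add_sum_erase _ _ (Finset.mem_univ σ)] at hM
    have h0 : ∑ τ ∈ Finset.univ.erase σ, ∏ i, M (τ i) i = 0 := by omega
    exact (Finset.sum_eq_zero_iff.1 h0) τ (Finset.mem_erase.2 ⟨hτ, Finset.mem_univ τ⟩)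
  rw [Matrix.det_apply', Finset.sum_eq_single σ]
  · refine mul_ne_zero ?_ ((hprod σ).2 hσ)
    exact_mod_cast (Equiv.Perm.sign σ).ne_zero
  · intro τ _ hτ
    have : ∏ i, W (τ i) i = 0 := by
      by_contra h
      exact (hprod τ).1 h (hrest τ hτ)
    rw [this, mul_zero]
  · intro h
    exact absurd (Finset.mem_univ σ) h

open Classical in
/-- The colouring equation at the underpass of `i` in terms of the labels of one arc `μ j` on each
long arc, all other labels being zero. -/
noncomputable def arcMatrix (D : DiagramData) (μ : D.C → ℕ) : Matrix D.C D.C ℝ :=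
  Matrix.of fun i j => (if D.Emanates i j (μ j) then 1 else 0) +
    (if D.ComesInto i j (μ j) then 1 else 0) - 2 * (if D.PassesThrough i j (μ j) then 1 else 0)

/-- The coefficients `1`, `1`, `-2` of the three kinds of incidence have no partial sum equal to zero
other than the sum of all three, which belongs to a cyclic crossing. -/
theorem arcMatrix_ne_zero_iff (hcyclic : ∀ i : D.C, ¬ D.IsCyclic i) (μ : D.C → ℕ) (i j : D.C) :
    D.arcMatrix μ i j ≠ 0 ↔ D.Incident i j (μ j) := by
  have h := hcyclic i
  simp only [IsCyclic, not_exists] at h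
  have h := h j (μ j)
  simp only [arcMatrix, Matrix.of_apply, Incident]
  by_cases h1 : D.Emanates i j (μ j) <;> by_cases h2 : D.ComesInto i j (μ j) <;>
    by_cases h3 : D.PassesThrough i j (μ j) <;> revert h <;> norm_num [h1, h2, h3]

theorem IsProper.arcMatrix_mulVec (hproper : D.IsProper) {x : D.Passage → ℝ}
    {μ : D.C → ℕ} {y : D.C → ℝ}
    (hx : ∀ j, ∀ m < D.arcLength j,
      x (D.point j m) = if D.arcNumber j m = μ j then y j else 0) (i : D.C) :
    (D.arcMatrix μ).mulVec y i =
      x (D.underpass i) + x (D.next.symm (D.underpass i)) - 2 * x (D.overpass i) := by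
  classical
  have e1 : ∑ j, (if D.Emanates i j (μ j) then 1 else 0) * y j = x (D.underpass i) := by
    rw [Finset.sum_eq_single i, ← point_zero, hx i 0 (hproper.arcLength_mem i).1]
    · have : D.Emanates i i (μ i) ↔ D.arcNumber i 0 = μ i := by
        rw [Emanates, eq_comm (a := D.arcNumber i 0)]
        simp [arcNumber]
      simp [this]
    · intro j _ hj
      rw [if_neg, zero_mul]
      exact fun h => hj h.1.symm
    · exact fun h => absurd (Finset.mem_univ i) h
  have e2 : ∑ j, (if D.ComesInto i j (μ j) then 1 else 0) * y j =
      x (D.next.symm (D.underpass i)) := by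
    obtain ⟨j, m, hm, hj⟩ := hproper.exists_point_eq (D.next.symm (D.underpass i))
    have hj1 : D.point j (m + 1) = D.underpass i := by
      rw [point_succ, hj, Equiv.apply_symm_apply]
    have hL : D.arcLength j = m + 1 := by
      by_contra hne
      have := not_isUnder_point m.succ_pos (show m.succ < D.arcLength j by omega)
      rw [Nat.succ_eq_add_one, hj1, isUnder_underpass] at this
      exact absurd this (by simp)
    rw [Finset.sum_eq_single j, ← hj, hx j m hm]
    · have : D.ComesInto i j (μ j) ↔ D.arcNumber j m = μ j := by
        rw [ComesInto, hL, arcNumber_succ, hj1]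
        simp [isVirtual, underpass]
      simp [this]
    · intro j' _ hj'
      rw [if_neg, zero_mul]
      rintro ⟨-, h⟩
      have hpos := (hproper.arcLength_mem j').1
      obtain ⟨m', hm'⟩ := Nat.exists_eq_succ_of_ne_zero hpos.ne'
      rw [hm', ← hj1, Nat.succ_eq_add_one, point_succ, point_succ] at h
      exact hj' (point_injective (by omega) hm (D.next.injective h)).1
    · exact fun h => absurd (Finset.mem_univ j) h
  have e3 : ∑ j, (if D.PassesThrough i j (μ j) then 1 else 0) * y j = x (D.overpass i) := by
    obtain ⟨j, m, hm, hj⟩ := hproper.exists_point_eq (D.overpass i)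
    rw [Finset.sum_eq_single j, ← hj, hx j m hm]
    · have : D.PassesThrough i j (μ j) ↔ D.arcNumber j m = μ j := by
        constructor
        · rintro ⟨m', hm', h1, h2⟩
          rwa [(point_injective hm hm' (hj.trans h2.symm)).2]
        · exact fun h => ⟨m, hm, h, hj⟩
      simp [this]
    · intro j' _ hj'
      rw [if_neg, zero_mul]
      rintro ⟨m', hm', -, h2⟩
      exact hj' (point_injective hm' hm (h2.trans hj.symm)).1
    · exact fun h => absurd (Finset.mem_univ j) h
  rw [← e1, ← e2, ← e3, Finset.mul_sum, ← Finset.sum_add_distrib, ← Finset.sum_sub_distrib]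
  simp only [Matrix.mulVec, dotProduct, arcMatrix, Matrix.of_apply]
  exact Finset.sum_congr rfl fun j _ => by ring

/-- For a special diagram as in the theorem, the colouring determinant has the greatest possible degree
in `u⁻¹`: the coefficient of this degree is nonzero, as the equations left for the labels of
the critical arcs form a regular system. -/
theorem det_scaledMap_zero_ne_zero (hproper : D.IsProper) (hspecial : D.IsSpecial)
    (hcyclic : ∀ i : D.C, ¬ D.IsCyclic i) (hperm : D.incidenceMatrix.permanent = 1) :
    LinearMap.det (D.scaledMap 0) ≠ 0 := by
  have hex : ∀ j, ∃ m < D.arcLength j, D.degree j m = D.numIncreasing j := fun j => by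
    obtain ⟨μ, m, hm, -, h⟩ := hspecial j
    exact ⟨m, hm, h⟩
  choose m₀ hm₀ hdeg using hex
  let μ : D.C → ℕ := fun j => D.arcNumber j (m₀ j)
  have hW : (D.arcMatrix μ).det ≠ 0 := by
    refine det_ne_zero_of_permanent_eq_one hperm fun i j => ?_
    rw [arcMatrix_ne_zero_iff hcyclic]
    have : (∃ ν, D.IsCritical j ν ∧ D.Incident i j ν) ↔ D.Incident i j (μ j) := by
      constructor
      · rintro ⟨ν, ⟨m, hm, rfl, h⟩, hinc⟩
        rwa [arcNumber_eq_of_critical hm h (hm₀ j) (hdeg j)] at hinc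
      · exact fun h => ⟨μ j, ⟨m₀ j, hm₀ j, rfl, hdeg j⟩, h⟩
    simp [incidenceMatrix, this]
  have hinj : Function.Injective (D.scaledMap 0) := by
    rw [← LinearMap.ker_eq_bot, LinearMap.ker_eq_bot']
    intro x hx
    have hlab : ∀ j, ∀ m < D.arcLength j, x (D.point j m) =
        if D.arcNumber j m = μ j then x (D.point j (m₀ j)) else 0 :=
      fun j m hm => label_eq_of_scaledMap_zero hx (hm₀ j) (hdeg j) hm
    have hy : (fun j => x (D.point j (m₀ j))) = 0 := by
      refine Matrix.eq_zero_of_mulVec_eq_zero hW (funext fun i => ?_)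
      rw [hproper.arcMatrix_mulVec hlab]
      have h1 : x (D.overpass i) - x (D.next.symm (D.overpass i)) = 0 :=
        congrFun hx (D.overpass i)
      have h2 : x (D.underpass i) + x (D.next.symm (D.underpass i)) - x (D.overpass i) -
        x (D.next.symm (D.overpass i)) = 0 := congrFun hx (D.underpass i)
      rw [Pi.zero_apply]
      linarith
    ext p
    obtain ⟨j, m, hm, rfl⟩ := hproper.exists_point_eq p
    rw [hlab j m hm, congrFun hy j]
    simp
  exact (LinearEquiv.isUnit_det' (LinearEquiv.ofInjectiveEndo _ hinj)).ne_zero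

end DiagramData
end VirtualKnot

theorem theorem2 (D : VirtualKnot.VirtualDiagram) (hproper : D.IsProper) (hspecial : D.IsSpecial)
    (hcyclic : ∀ i : D.C, ¬ D.IsCyclic i) (hperm : D.incidenceMatrix.permanent = 1) :
    D.IsMinimal := by
  intro D' h
  exact (VirtualKnot.VirtualDiagram.proportionalDet_of_link_eq h.symm).card_le hproper.1
      (VirtualKnot.DiagramData.det_scaledMap_zero_ne_zero hproper hspecial hcyclic hperm)
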